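/- Let $q\neq 0$ and $\kappa\neq 0$ be real. Indices $a,b,\dots\in\{1,2,3,4\}$ stand for the pairs $(AA')=(11),(12),(21),(22)$, and repeated indices are summed. **R-matrices and metric.** Let $R$ be the standard $SU_q(2)$ R-matrix: in the order $11,12,21,22$ of the index pairs it has diagonal $(q,1,1,q)$, the entry $R^{12}{}_{21}=q-q^{-1}$, and zeros elsewhere; $\widetilde R=((R^{t_2})^{-1})^{t_2}$ with $t_2$ the transposition in the second tensor factor. Put $$R_M{}^{ab}{}_{cd}=R^{-1\,LC}{}_{BI}\,R^{B'I}{}_{JA}\,R^{A'J}{}_{KD'}\,\widetilde R^{KD}{}_{C'L},\qquad R_L{}^{ab}{}_{cd}=R^{CI}{}_{JB}\,R^{B'J}{}_{KA}\,R^{A'K}{}_{LD'}\,\widetilde R^{LD}{}_{C'I},$$ $$g^{ab}=\kappa\,\varepsilon_{AC}R^{A'C}{}_{DB}\,\varepsilon^{DB'},\qquad \varepsilon_{12}=q^{-1/2},\ \ \varepsilon_{21}=-q^{1/2},\ \ \varepsilon_{11}=\varepsilon_{22}=0,\ \ \varepsilon^{AB}=-\varepsilon_{BA},$$ and let $g_{ab}$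 be determined by $g_{ab}g^{cb}=\delta_a^c$. Indices are raised by $T^b=T_a g^{ab}$ and lowered by $T_a=g_{ab}T^b$. The number $\kappa$ is a free normalisation of the metric; $\kappa=1$ makes the antisymmetrisers below projectors. **q-Minkowski space and braided derivatives.** $M_q$ is the unital $\mathbb C$-algebra with generators $x_a$ and relations $x_ax_b=x_dx_c\,R_M{}^{cd}{}_{ab}$. The braided differential operators $\partial^a:M_q\to M_q$ are the linear maps with $\partial^a1=0$ and $\partial^a(x_bf)=\delta^a_b f+R_L^{-1\,ad}{}_{cb}\,x_d\,\partial^cf$ for all $f\in M_q$. Put $\partial_a=g_{ab}\partial^b$ and $\Box=\partial_a\partial_b\,g^{ab}$. **Antisymmetrisers.** A tensor is totally q-antisymmetric if $T_{\dots ab\dots}=-T_{\dots cd\dots}R_L{}^{dc}{}_{ab}$ for any two adjacent indices. Let $\varepsilon_{abcd}$ be the totally q-antisymmetric complex tensor with $\varepsilon_{1234}=1$. Put $n_1=n_3=2(1+q^2+q^4)$, $n_2=(1+q^2)^2$, $n_0=n_4=q^{-2}n_1n_2$. For $1\le k\le 4$ let $$A_{\{k\}}{}^{c_1\dots c_k}{}_{a_1\dots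 a_k}=\frac{(-1)^k}{n_k}\,\varepsilon^{m_{4-k}\dots m_1c_k\dots c_1}\,\varepsilon_{m_1\dots m_{4-k}a_1\dots a_k},\qquad T_{[a_1\dots a_k]}=T_{c_1\dots c_k}A_{\{k\}}{}^{c_1\dots c_k}{}_{a_1\dots a_k},$$ and $T_{[a_1\dots a_k]}=0$ for $k>4$. **Forms.** A $p$-form $w$ is given by its values $w_{a_1\dots a_p}\in M_q$ on the generators $dx_{a_1}\wedge\dots\wedge dx_{a_p}$ of the exterior algebra, a totally q-antisymmetric family; a 1-form $A$ is thus given by four arbitrary elements $A_1,\dots,A_4$ of $M_q$. Let $(dw)_{a_1\dots a_{p+1}}=\partial_{[a_1}w_{a_2\dots a_{p+1}]}$, $$({}^*w)_{a_1\dots a_{4-p}}=n_p^{-1/2}\,\varepsilon_{a_1\dots a_{4-p}b_1\dots b_p}\,g^{b_1c_p}\cdots g^{b_pc_1}\,w_{c_1\dots c_p},$$ and $\delta={}^*d\,{}^*$. **Proposition.** For every 1-form $A$ on $M_q$, the q-Maxwell equation $\delta dA=0$ is equivalent to the four equations $$\partial^c\partial_{[c}A_{z]}=0\qquad(z=1,\dots,4),$$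 and it is also equivalent to the four equations $$\Box A_z-\partial_z\partial^cA_c=0\qquad(z=1,\dots,4).$$ -/

import Mathlib

/-! # The calculus of forms on q-Minkowski space

Throughout, a tensor `T` with two upper and two lower indices is written as a function
`T a b c d`, the upper pair `a b` coming first. Four-valued indices `0, 1, 2, 3 : Fin 4` stand for
the multi-indices `(A A') = (11), (12), (21), (22)`. -/

noncomputable section

namespace QMinkowski

/-! ## R-matrices and the metric -/

/-- Left half `A` of the multi-index `a = (A A')`. -/
def lft (a : Fin 4) : Fin 2 := ![0, 0, 1, 1] a

/-- Right half `A'` of the multi-index `a = (A A')`. -/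
def rgt (a : Fin 4) : Fin 2 := ![0, 1, 0, 1] a

/-- Two upper, two lower indices as a matrix: rows are the upper pair, columns the lower pair. -/
def toMat {n : ℕ} (T : Fin n → Fin n → Fin n → Fin n → ℂ) :
    Matrix (Fin n × Fin n) (Fin n × Fin n) ℂ :=
  Matrix.of fun x y => T x.1 x.2 y.1 y.2

/-- The inverse of such a tensor, as a matrix. -/
def tinv {n : ℕ} (T : Fin n → Fin n → Fin n → Fin n → ℂ) (a b c d : Fin n) : ℂ :=
  (toMat T)⁻¹ (a, b) (c, d)

/-- Transposition in the second tensor component. -/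
def t2 {n : ℕ} (T : Fin n → Fin n → Fin n → Fin n → ℂ) (a b c d : Fin n) : ℂ := T a d c b

/-- The standard R-matrix of `SU_q(2)`; the rows and columns of the matrix are in the order
`11, 12, 21, 22`. -/
def R (q : ℝ) (a b c d : Fin 2) : ℂ :=
  let M : Matrix (Fin 4) (Fin 4) ℂ :=
    !![(q : ℂ), 0, 0, 0; 0, 1, (q : ℂ) - (q : ℂ)⁻¹, 0; 0, 0, 1, 0; 0, 0, 0, (q : ℂ)]
  M (finProdFinEquiv (a, b)) (finProdFinEquiv (c, d))

/-- `R⁻¹`. -/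
def Rinv (q : ℝ) : Fin 2 → Fin 2 → Fin 2 → Fin 2 → ℂ := tinv (R q)

/-- `R̃ = ((R^{t₂})⁻¹)^{t₂}`. -/
def Rtil (q : ℝ) : Fin 2 → Fin 2 → Fin 2 → Fin 2 → ℂ := t2 (tinv (t2 (R q)))

/-- `(R_M)^{ab}_{cd}`, the matrix of the commutation relations of q-Minkowski space. -/
def RM (q : ℝ) (a b c d : Fin 4) : ℂ :=
  ∑ I, ∑ J, ∑ K, ∑ L,
    Rinv q L (lft c) (lft b) I * R q (rgt b) I J (lft a) *
      R q (rgt a) J K (rgt d) * Rtil q K (lft d) (rgt c) L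

/-- `(R_L)^{ab}_{cd}`, the matrix of the q-Lorentz group and of the braiding. -/
def RL (q : ℝ) (a b c d : Fin 4) : ℂ :=
  ∑ I, ∑ J, ∑ K, ∑ L,
    R q (lft c) I J (lft b) * R q (rgt b) J K (lft a) *
      R q (rgt a) K L (rgt d) * Rtil q L (lft d) (rgt c) I

/-- `(R_L⁻¹)^{ab}_{cd}`. -/
def RLinv (q : ℝ) : Fin 4 → Fin 4 → Fin 4 → Fin 4 → ℂ := tinv (RL q)

/-- A square root of `q`. -/
def sqrtq (q : ℝ) : ℂ := (q : ℂ) ^ (1 / 2 : ℂ)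

/-- The spinor metric `ε_{AB}`. -/
def spinLow (q : ℝ) : Matrix (Fin 2) (Fin 2) ℂ := !![0, 1 / sqrtq q; -sqrtq q, 0]

/-- The spinor metric `ε^{AB} = -ε_{BA}` with upper indices. -/
def spinUp (q : ℝ) : Matrix (Fin 2) (Fin 2) ℂ := -(spinLow q).transpose

/-- The q-metric `g^{ab} = κ ε_{AC} R^{A'C}_{DB} ε^{DB'}` with normalisation factor `κ`. -/
def gUp (q κ : ℝ) : Matrix (Fin 4) (Fin 4) ℂ := Matrix.of fun a b =>
  (κ : ℂ) * ∑ C, ∑ D, spinLow q (lft a) C * R q (rgt a) C D (lft b) * spinUp q D (rgt b)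

/-- The q-metric `g_{ab}` with lower indices. Indices are raised by `T^b = T_a g^{ab}` and lowered
by `T_a = g_{ab} T^b`, so that `g_{ab} g^{cb} = δ_a^c`. -/
def gLow (q κ : ℝ) : Matrix (Fin 4) (Fin 4) ℂ := ((gUp q κ)⁻¹).transpose

/-! ## Polynomial certificates

A list of integers represents a polynomial in `q`. This is only used to verify identities between
the entries of the R-matrices. -/

/-- The value at `q` of the polynomial with the given coefficients, the constant one first. -/
def ev (q : ℂ) : List ℤ → ℂ
  | [] => 0
  | c :: p => (c : ℂ) + q * ev q p

/-- Addition of coefficient lists. -/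
def padd (p : List ℤ) : List ℤ → List ℤ :=
  List.rec (motive := fun _ => List ℤ → List ℤ) (fun s => s)
    (fun c p ih s => List.casesOn s (c :: p) fun d s => (c + d) :: ih s) p

/-- Multiplication of a coefficient list by an integer. -/
def psmul (c : ℤ) (s : List ℤ) : List ℤ :=
  List.rec (motive := fun _ => List ℤ) [] (fun d _ ih => (c * d) :: ih) s

/-- Multiplication of coefficient lists. -/
def pmul (p s : List ℤ) : List ℤ :=
  List.rec (motive := fun _ => List ℤ) [] (fun c _ ih => padd (psmul c s) (0 :: ih)) p

/-- All coefficients vanish. -/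
def pzero (p : List ℤ) : Bool :=
  List.rec (motive := fun _ => Bool) true (fun c _ ih => (c == 0) && ih) p

/-- The two coefficient lists represent the same polynomial. -/
def peq (p s : List ℤ) : Bool := pzero (padd p (psmul (-1) s))

/-- The sum of two coefficient lists with indices `0, 1`. -/
def psum2 (f : ℕ → List ℤ) : List ℤ := padd (f 0) (f 1)

/-- The sum of four coefficient lists with indices `0, 1, 2, 3`. -/
def psum4 (f : ℕ → List ℤ) : List ℤ := padd (f 0) (padd (f 1) (padd (f 2) (f 3)))

/-- A check for the indices `0, 1`. -/
def all2 (f : ℕ → Bool) : Bool := f 0 && f 1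

/-- A check for the indices `0, 1, 2, 3`. -/
def all4 (f : ℕ → Bool) : Bool := f 0 && (f 1 && (f 2 && f 3))

theorem all2_apply {f : ℕ → Bool} (h : all2 f = true) (a : Fin 2) : f a = true := by
  simp only [all2, Bool.and_eq_true] at h
  fin_cases a
  exacts [h.1, h.2]

theorem all4_apply {f : ℕ → Bool} (h : all4 f = true) (a : Fin 4) : f a = true := by
  simp only [all4, Bool.and_eq_true] at h
  fin_cases a
  exacts [h.1, h.2.1, h.2.2.1, h.2.2.2]

theorem ev_padd (q : ℂ) (p s : List ℤ) : ev q (padd p s) = ev q p + ev q s := by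
  induction p generalizing s with
  | nil => simp [padd, ev]
  | cons c p ih => cases s with
    | nil => simp [padd, ev]
    | cons d s =>
      change ev q ((c + d) :: padd p s) = _
      simp only [ev, ih]; push_cast; ring

theorem ev_psmul (q : ℂ) (c : ℤ) (s : List ℤ) : ev q (psmul c s) = c * ev q s := by
  induction s with
  | nil => simp [psmul, ev]
  | cons d s ih =>
    change ev q ((c * d) :: psmul c s) = _
    simp only [ev, ih]; push_cast; ring

theorem ev_pmul (q : ℂ) (p s : List ℤ) : ev q (pmul p s) = ev q p * ev q s := by
  induction p with
  | nil => simp [pmul, ev]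
  | cons c p ih =>
    change ev q (padd (psmul c s) (0 :: pmul p s)) = _
    simp only [ev, ih, ev_padd, ev_psmul]; push_cast; ring

theorem ev_pzero (q : ℂ) (p : List ℤ) (h : pzero p = true) : ev q p = 0 := by
  induction p with
  | nil => rfl
  | cons c p ih =>
    change ((c == 0) && pzero p) = true at h
    simp only [Bool.and_eq_true, beq_iff_eq] at h
    simp [ev, h.1, ih h.2]

theorem ev_peq (q : ℂ) {p s : List ℤ} (h : peq p s = true) : ev q p = ev q s := by
  have := ev_pzero q _ h
  rw [ev_padd, ev_psmul] at this
  push_cast at this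
  linear_combination this

theorem ev_psum2 (q : ℂ) (f : ℕ → List ℤ) : ev q (psum2 f) = ∑ i : Fin 2, ev q (f i) := by
  simp [psum2, ev_padd, Fin.sum_univ_two]

theorem ev_psum4 (q : ℂ) (f : ℕ → List ℤ) : ev q (psum4 f) = ∑ i : Fin 4, ev q (f i) := by
  simp only [psum4, ev_padd, Fin.sum_univ_four]
  simp [add_assoc]

/-- The polynomial `q ^ n` if the two pairs of indices agree, and zero otherwise. -/
def pdelta (n a b c d : ℕ) : List ℤ :=
  if (a == c) && (b == d) then List.replicate n 0 ++ [1] else []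

theorem ev_pdelta {m : ℕ} (q : ℂ) (n : ℕ) (a b c d : Fin m) :
    ev q (pdelta n a b c d) = q ^ n * if a = c ∧ b = d then 1 else 0 := by
  have : ev q (List.replicate n 0 ++ [1]) = q ^ n := by
    induction n with
    | zero => simp [ev]
    | succ n ih => simp [List.replicate_succ, ev, ih, pow_succ']
  simp only [pdelta, Bool.and_eq_true, beq_iff_eq, Fin.val_inj]
  split_ifs <;> simp [this, ev]

/-- Entry `n` of a list, the empty list if there is none. -/
def look {α : Type} (l : List (List α)) : ℕ → List α :=
  List.rec (motive := fun _ => ℕ → List α) (fun _ => [])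
    (fun x _ ih n => Nat.casesOn n x fun n => ih n) l

/-- An entry of a tensor given as a nested list, in which trailing zeros may be left out. -/
def look4 (t : List (List (List (List (List ℤ))))) (a b c d : ℕ) : List ℤ :=
  look (look (look (look t a) b) c) d

/-- The entries of `q R`. -/
def pR : ℕ → ℕ → ℕ → ℕ → List ℤ := look4
   [[[[[0, 0, 1]]], [[[], [0, 1]], [[-1, 0, 1]]]],
    [[[], [[0, 1]]], [[], [[], [0, 0, 1]]]]]

/-- The entries of `q R⁻¹`. -/
def pRinv : ℕ → ℕ → ℕ → ℕ → List ℤ := look4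
   [[[[[1]]], [[[], [0, 1]], [[1, 0, -1]]]],
    [[[], [[0, 1]]], [[], [[], [1]]]]]

/-- The entries of `q³ R̃`. -/
def pRtil : ℕ → ℕ → ℕ → ℕ → List ℤ := look4
   [[[[[0, 0, 1]]], [[[], [0, 0, 0, 1]], [[1, 0, -1]]]],
    [[[], [[0, 0, 0, 1]]], [[], [[], [0, 0, 1]]]]]

/-- The entries of `q⁴ R_M`. -/
def pRM : ℕ → ℕ → ℕ → ℕ → List ℤ := look4
   [[[[[0, 0, 0, 0, 1]], [[], [], [0, 0, 1, 0, -1]], [[], [0, 0, -1, 0, 1]], [[0, 0, 1, 0, -2, 0,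
      1], [], [], [-1, 0, 2, 0, -1]]], [[[], [0, 0, 1]], [[0, 0, -1, 0, 1], [], [], [1, 0,
      -1]]], [[[], [], [0, 0, 0, 0, 0, 0, 1]], [], [[0, 0, 0, 0, 1, 0, -1], [], [], [0, 0, -1,
      0, 1]], [[], [], [1, 0, -1, 0, -1, 0, 1]]], [[[], [], [], [0, 0, 0, 0, 1]], [[], [], [0,
      0, -1, 0, 1]], [[], [0, 0, 1, 0, -1]], [[0, 0, -1, 0, 2, 0, -1], [], [], [1, 0, -2, 0,
      1]]]],
    [[[], [[0, 0, 0, 0, 1]], [], [[], [0, 0, 0, 0, -1, 0, 1]]], [[], [[], [0, 0, 0, 0, 1]]],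
      [[], [[], [], [0, 0, 0, 0, 1]], [], [[0, 0, 0, 0, 1, 0, -1], [], [], [0, 0, -1, 0, 1]]],
      [[], [[], [], [], [0, 0, 0, 0, 1]], [], [[], [0, 0, 0, 0, 1, 0, -1]]]],
    [[[], [], [[0, 0, 0, 0, 1]], [[], [], [0, 0, 1, 0, -1]]], [[], [], [[], [0, 0, 0, 0, 1]],
      [[0, 0, 0, 0, -1, 0, 1], [], [], [0, 0, 1, 0, -1]]], [[], [], [[], [], [0, 0, 0, 0, 1]]],
      [[], [], [[], [], [], [0, 0, 0, 0, 1]], [[], [], [0, 0, -1, 0, 1]]]],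
    [[[], [], [], [[0, 0, 0, 0, 1]]], [[], [], [], [[], [0, 0, 0, 0, 0, 0, 1]]], [[], [], [],
      [[], [], [0, 0, 1]]], [[], [], [], [[], [], [], [0, 0, 0, 0, 1]]]]]

/-- The entries of `q⁴ R_L`. -/
def pRL : ℕ → ℕ → ℕ → ℕ → List ℤ := look4
   [[[[[0, 0, 0, 0, 0, 0, 1], [], [], [0, 0, 1, 0, -2, 0, 1]], [[], [], [-1, 0, 3, 0, -2]], [[],
      [0, 0, -1, 0, 1]], [[0, 0, 1, 0, -2, 0, 1], [], [], [-1, 0, 2, 0, -1]]], [[[], [0, 0, 0,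
      0, 1]], [[0, 0, 0, 0, -1, 0, 1], [], [], [0, 0, 1, 0, -1]]], [[[], [], [0, 0, 0, 0, 0, 0,
      1]], [], [[], [], [], [0, 0, 0, 0, -1, 0, 1]], [[], [], [0, 0, 1, 0, -2, 0, 1]]], [[[],
      [], [], [0, 0, 0, 0, 1]], [[], [], [0, 0, -1, 0, 1]]]],
    [[[], [[0, 0, 0, 0, 0, 0, 1], [], [], [0, 0, 1, 0, -2, 0, 1]], [], [[], [0, 0, 0, 0, -1, 0,
      1]]], [[], [[], [0, 0, 0, 0, 0, 0, 1]]], [[], [[], [], [0, 0, 0, 0, 1]], [], [[], [], [],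
      [0, 0, 0, 0, -1, 0, 1]]], [[], [[], [], [], [0, 0, 0, 0, 1]]]],
    [[[[], [], [0, 0, 0, 0, -1, 0, 1]], [], [[0, 0, 0, 0, 1]], [[], [], [0, 0, 1, 0, -1]]],
      [[[], [], [], [0, 0, 0, 0, -1, 0, 1]], [[], [], [0, 0, 1, 0, -2, 0, 1]], [[], [0, 0, 0,
      0, 1]], [[0, 0, 0, 0, -1, 0, 1], [], [], [0, 0, 1, 0, -1]]], [[], [], [[], [], [0, 0, 0,
      0, 0, 0, 1]]], [[], [], [[], [], [], [0, 0, 0, 0, 0, 0, 1]], [[], [], [0, 0, 0, 0, -1, 0,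
      1]]]],
    [[[], [[], [], [0, 0, -1, 0, 1]], [], [[0, 0, 0, 0, 1]]], [[], [[], [], [], [0, 0, 0, 0,
      -1, 0, 1]], [], [[], [0, 0, 0, 0, 0, 0, 1]]], [[], [], [], [[], [], [0, 0, 0, 0, 1]]],
      [[], [], [], [[], [], [], [0, 0, 0, 0, 0, 0, 1]]]]]

/-- The entries of `q⁴ R_L⁻¹`. -/
def pRLinv : ℕ → ℕ → ℕ → ℕ → List ℤ := look4
   [[[[[0, 0, 1]], [[], [], [0, 0, -1, 0, 1]], [[], [1, 0, -1]], [[], [], [], [-1, 0, 2, 0, -1]]],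
      [[[], [0, 0, 0, 0, 1]], [[0, 0, 1, 0, -1], [], [], [0, 0, -1, 0, 1]], [], [[], [1, 0, -2,
      0, 1]]], [[[], [], [0, 0, 1]], [], [[], [], [], [1, 0, -1]]], [[[], [], [], [0, 0, 0, 0,
      1]], [[], [], [0, 0, 1, 0, -1]], [], [[], [], [], [1, 0, -2, 0, 1]]]],
    [[[], [[0, 0, 1]], [], [[], [1, 0, -1]]], [[], [[], [0, 0, 1]]], [[], [[], [], [0, 0, 0, 0,
      1]], [], [[], [], [], [0, 0, 1, 0, -1]]], [[], [[], [], [], [0, 0, 0, 0, 1]]]],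
    [[[[], [], [0, 0, 1, 0, -1]], [], [[0, 0, 0, 0, 1], [], [], [1, 0, -2, 0, 1]], [[], [], [0,
      0, -1, 0, 1]]], [[[], [], [], [0, 0, 0, 0, 1, 0, -1]], [[], [], [0, 0, 1, 0, -2, 0, 1]],
      [[], [0, 0, 0, 0, 1]], [[0, 0, 0, 0, 1, 0, -1], [], [], [0, 0, -2, 0, 3, 0, -1]]], [[],
      [], [[], [], [0, 0, 1]]], [[], [], [[], [], [], [0, 0, 1]], [[], [], [0, 0, 1, 0, -1]]]],
    [[[], [[], [], [0, 0, 1, 0, -1]], [], [[0, 0, 0, 0, 1], [], [], [1, 0, -2, 0, 1]]], [[],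
      [[], [], [], [0, 0, 1, 0, -1]], [], [[], [0, 0, 1]]], [[], [], [], [[], [], [0, 0, 0, 0,
      1]]], [[], [], [], [[], [], [], [0, 0, 1]]]]]

theorem R_eq {q : ℝ} (hq : q ≠ 0) (a b c d : Fin 2) : (q : ℂ) * R q a b c d = ev q (pR a b c d) := by
  have h : (q : ℂ) ≠ 0 := by exact_mod_cast hq
  fin_cases a <;> fin_cases b <;> fin_cases c <;> fin_cases d <;>
    simp [R, pR, look4, look, ev, finProdFinEquiv]
  all_goals field_simp
  all_goals ring

/-- A certificate for the inverse of a tensor. -/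
theorem tinv_eq {n : ℕ} {T S : Fin n → Fin n → Fin n → Fin n → ℂ}
    (h : ∀ a b c d, ∑ i, ∑ j, T a b i j * S i j c d = if a = c ∧ b = d then 1 else 0) :
    tinv T = S := by
  have : toMat T * toMat S = 1 := by
    ext ⟨a, b⟩ ⟨c, d⟩
    simp only [Matrix.mul_apply, Fintype.sum_prod_type, toMat, Matrix.of_apply, h, Matrix.one_apply,
      Prod.mk.injEq]
  funext a b c d
  rw [tinv, Matrix.inv_eq_right_inv this]
  rfl

theorem Rinv_eq {q : ℝ} (hq : q ≠ 0) (a b c d : Fin 2) :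
    (q : ℂ) * Rinv q a b c d = ev q (pRinv a b c d) := by
  have h : (q : ℂ) ≠ 0 := by exact_mod_cast hq
  have key : (all2 fun a => all2 fun b => all2 fun c => all2 fun d =>
      peq (psum2 fun i => psum2 fun j => pmul (pR a b i j) (pRinv i j c d))
        (pdelta 2 a b c d)) = true := by decide +kernel
  have : Rinv q = fun a b c d : Fin 2 => (q : ℂ)⁻¹ * ev q (pRinv a b c d) := by
    refine tinv_eq fun a b c d => ?_
    have := ev_peq (q : ℂ) (all2_apply (all2_apply (all2_apply (all2_apply key a) b) c) d)
    simp only [ev_psum2, ev_pmul, ev_pdelta, ← R_eq hq] at this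
    simp only [mul_left_comm _ (q : ℂ)⁻¹, ← Finset.mul_sum]
    simp only [mul_assoc, ← Finset.mul_sum] at this
    rw [inv_mul_eq_iff_eq_mul₀ h]
    apply mul_left_cancel₀ h
    rw [this]
    ring
  rw [this, mul_inv_cancel_left₀ h]

theorem Rtil_eq {q : ℝ} (hq : q ≠ 0) (a b c d : Fin 2) :
    (q : ℂ) ^ 3 * Rtil q a b c d = ev q (pRtil a b c d) := by
  have h : (q : ℂ) ≠ 0 := by exact_mod_cast hq
  have key : (all2 fun a => all2 fun b => all2 fun c => all2 fun d =>
      peq (psum2 fun i => psum2 fun j => pmul (pR a j i b) (pRtil i d c j))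
        (pdelta 4 a b c d)) = true := by decide +kernel
  have : tinv (t2 (R q)) = fun a b c d : Fin 2 => ((q : ℂ) ^ 3)⁻¹ * ev q (pRtil a d c b) := by
    refine tinv_eq fun a b c d => ?_
    have := ev_peq (q : ℂ) (all2_apply (all2_apply (all2_apply (all2_apply key a) b) c) d)
    simp only [ev_psum2, ev_pmul, ev_pdelta, ← R_eq hq] at this
    simp only [t2, mul_left_comm _ ((q : ℂ) ^ 3)⁻¹, ← Finset.mul_sum]
    simp only [mul_assoc, ← Finset.mul_sum] at this
    rw [inv_mul_eq_iff_eq_mul₀ (pow_ne_zero 3 h)]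
    apply mul_left_cancel₀ h
    rw [this]
    ring
  rw [Rtil, t2, this, mul_inv_cancel_left₀ (pow_ne_zero 3 h)]

theorem lft_val (a : Fin 4) : ((lft a : Fin 2) : ℕ) = a / 2 := by fin_cases a <;> rfl

theorem rgt_val (a : Fin 4) : ((rgt a : Fin 2) : ℕ) = a % 2 := by fin_cases a <;> rfl

theorem RM_eq {q : ℝ} (hq : q ≠ 0) (a b c d : Fin 4) :
    (q : ℂ) ^ 4 * RM q a b c d = ev q (pRM a b c d) := by
  have h : (q : ℂ) ≠ 0 := by exact_mod_cast hq
  have key : (all4 fun a => all4 fun b => all4 fun c => all4 fun d => peq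
      (psum2 fun I => psum2 fun J => psum2 fun K => psum2 fun L =>
        pmul (pmul (pmul (pRinv L (c / 2) (b / 2) I) (pR (b % 2) I J (a / 2)))
          (pR (a % 2) J K (d % 2))) (pRtil K (d / 2) (c % 2) L))
      (0 :: 0 :: pRM a b c d)) = true := by decide +kernel
  have := ev_peq (q : ℂ) (all4_apply (all4_apply (all4_apply (all4_apply key a) b) c) d)
  simp only [ev_psum2, ev_pmul, ← lft_val, ← rgt_val, ← R_eq hq, ← Rinv_eq hq, ← Rtil_eq hq, ev]
    at this
  have h2 : (q : ℂ) ^ 6 * RM q a b c d = (q : ℂ) ^ 2 * ev q (pRM a b c d) := by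
    rw [RM]
    simp only [Finset.mul_sum]
    rw [show (q : ℂ) ^ 2 * ev q (pRM a b c d) = ((0 : ℤ) : ℂ) + q * (((0 : ℤ) : ℂ) +
      q * ev q (pRM a b c d)) by push_cast; ring, ← this]
    refine Finset.sum_congr rfl fun I _ => Finset.sum_congr rfl fun J _ =>
      Finset.sum_congr rfl fun K _ => Finset.sum_congr rfl fun L _ => ?_
    ring
  apply mul_left_cancel₀ (pow_ne_zero 2 h)
  rw [← h2]; ring

theorem RL_eq {q : ℝ} (hq : q ≠ 0) (a b c d : Fin 4) :
    (q : ℂ) ^ 4 * RL q a b c d = ev q (pRL a b c d) := by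
  have h : (q : ℂ) ≠ 0 := by exact_mod_cast hq
  have key : (all4 fun a => all4 fun b => all4 fun c => all4 fun d => peq
      (psum2 fun I => psum2 fun J => psum2 fun K => psum2 fun L =>
        pmul (pmul (pmul (pR (c / 2) I J (b / 2)) (pR (b % 2) J K (a / 2)))
          (pR (a % 2) K L (d % 2))) (pRtil L (d / 2) (c % 2) I))
      (0 :: 0 :: pRL a b c d)) = true := by decide +kernel
  have := ev_peq (q : ℂ) (all4_apply (all4_apply (all4_apply (all4_apply key a) b) c) d)
  simp only [ev_psum2, ev_pmul, ← lft_val, ← rgt_val, ← R_eq hq, ← Rtil_eq hq, ev] at this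
  have h2 : (q : ℂ) ^ 6 * RL q a b c d = (q : ℂ) ^ 2 * ev q (pRL a b c d) := by
    rw [RL]
    simp only [Finset.mul_sum]
    rw [show (q : ℂ) ^ 2 * ev q (pRL a b c d) = ((0 : ℤ) : ℂ) + q * (((0 : ℤ) : ℂ) +
      q * ev q (pRL a b c d)) by push_cast; ring, ← this]
    refine Finset.sum_congr rfl fun I _ => Finset.sum_congr rfl fun J _ =>
      Finset.sum_congr rfl fun K _ => Finset.sum_congr rfl fun L _ => ?_
    ring
  apply mul_left_cancel₀ (pow_ne_zero 2 h)
  rw [← h2]; ring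

theorem RLinv_eq {q : ℝ} (hq : q ≠ 0) (a b c d : Fin 4) :
    (q : ℂ) ^ 4 * RLinv q a b c d = ev q (pRLinv a b c d) := by
  have h : (q : ℂ) ≠ 0 := by exact_mod_cast hq
  have key : (all4 fun a => all4 fun b => all4 fun c => all4 fun d =>
      peq (psum4 fun i => psum4 fun j => pmul (pRL a b i j) (pRLinv i j c d))
        (pdelta 8 a b c d)) = true := by decide +kernel
  have : RLinv q = fun a b c d : Fin 4 => ((q : ℂ) ^ 4)⁻¹ * ev q (pRLinv a b c d) := by
    refine tinv_eq fun a b c d => ?_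
    have := ev_peq (q : ℂ) (all4_apply (all4_apply (all4_apply (all4_apply key a) b) c) d)
    simp only [ev_psum4, ev_pmul, ev_pdelta, ← RL_eq hq] at this
    simp only [mul_left_comm _ ((q : ℂ) ^ 4)⁻¹, ← Finset.mul_sum]
    simp only [mul_assoc, ← Finset.mul_sum] at this
    rw [inv_mul_eq_iff_eq_mul₀ (pow_ne_zero 4 h)]
    apply mul_left_cancel₀ (pow_ne_zero 4 h)
    rw [this]
    ring
  rw [this, mul_inv_cancel_left₀ (pow_ne_zero 4 h)]

/-- The tensor of the linear part of the braided Leibniz rule annihilates the relations. -/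
theorem rel_one {q : ℝ} (hq : q ≠ 0) (a b e d : Fin 4) :
    (if e = a ∧ d = b then 1 else 0) + RLinv q e d b a =
      RM q d e a b + ∑ u, ∑ v, RM q u v a b * RLinv q e d u v := by
  have h : (q : ℂ) ≠ 0 := by exact_mod_cast hq
  have key : (all4 fun a => all4 fun b => all4 fun e => all4 fun d => peq
      (padd (pdelta 8 e d a b) (0 :: 0 :: 0 :: 0 :: pRLinv e d b a))
      (padd (0 :: 0 :: 0 :: 0 :: pRM d e a b)
        (psum4 fun u => psum4 fun v => pmul (pRM u v a b) (pRLinv e d u v)))) = true := by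
    decide +kernel
  have := ev_peq (q : ℂ) (all4_apply (all4_apply (all4_apply (all4_apply key a) b) e) d)
  simp only [ev_psum4, ev_pmul, ev_pdelta, ev_padd, ev, ← RM_eq hq, ← RLinv_eq hq] at this
  apply mul_left_cancel₀ (pow_ne_zero 8 h)
  rw [mul_add, mul_add, Finset.mul_sum]
  simp only [Finset.mul_sum]
  convert this using 2
  · push_cast; ring
  · push_cast; ring
  · refine Finset.sum_congr rfl fun u _ => Finset.sum_congr rfl fun v _ => ?_
    ring

theorem ybe_cert : (all4 fun a => all4 fun b => all4 fun e => all4 fun c => all4 fun d =>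
    all4 fun f => peq
      (psum4 fun u => psum4 fun v => pmul (pRM u v a b)
        (psum4 fun g => pmul (pRLinv e d g v) (pRLinv g f c u)))
      (psum4 fun u => psum4 fun v => pmul (pRM f d u v)
        (psum4 fun g => pmul (pRLinv e u g a) (pRLinv g v c b)))) = true := by
  decide +kernel

/-- The mixed Yang-Baxter equation. -/
theorem rel_two {q : ℝ} (hq : q ≠ 0) (a b e c d f : Fin 4) :
    ∑ u, ∑ v, RM q u v a b * ∑ g, RLinv q e d g v * RLinv q g f c u =
      ∑ u, ∑ v, RM q f d u v * ∑ g, RLinv q e u g a * RLinv q g v c b := by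
  have h : (q : ℂ) ≠ 0 := by exact_mod_cast hq
  have := ev_peq (q : ℂ) (all4_apply (all4_apply (all4_apply (all4_apply (all4_apply
    (all4_apply ybe_cert a) b) e) c) d) f)
  simp only [ev_psum4, ev_pmul, ← RM_eq hq, ← RLinv_eq hq] at this
  apply mul_left_cancel₀ (pow_ne_zero 12 h)
  calc _ = _ := ?_
    _ = _ := this
    _ = _ := ?_
  all_goals
    simp only [Finset.mul_sum]
    refine Finset.sum_congr rfl fun u _ => Finset.sum_congr rfl fun v _ =>
      Finset.sum_congr rfl fun g _ => ?_
    ring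

/-! ## q-Minkowski space and the braided differential operators -/

/-- The relations `x_a x_b = x_d x_c (R_M)^{cd}_{ab}`. -/
inductive Rel (q : ℝ) : FreeAlgebra ℂ (Fin 4) → FreeAlgebra ℂ (Fin 4) → Prop
  | comm (a b : Fin 4) :
      Rel q (FreeAlgebra.ι ℂ a * FreeAlgebra.ι ℂ b)
        (∑ c, ∑ d, RM q c d a b • (FreeAlgebra.ι ℂ d * FreeAlgebra.ι ℂ c))

/-- The algebra `M_q` of q-Minkowski space: the quantum covector algebra of `R_M`. -/
abbrev Mq (q : ℝ) : Type := RingQuot (Rel q)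

/-- The generators `x_a` of q-Minkowski space. -/
def x (q : ℝ) (a : Fin 4) : Mq q := RingQuot.mkAlgHom ℂ (Rel q) (FreeAlgebra.ι ℂ a)

theorem x_mul_x (q : ℝ) (a b : Fin 4) :
    x q a * x q b = ∑ c, ∑ d, RM q c d a b • (x q d * x q c) := by
  have := RingQuot.mkAlgHom_rel ℂ (Rel.comm (q := q) a b)
  simpa only [map_mul, map_sum, map_smul, x] using this

/-- If `h_c` are the derivatives `∂^c f` of `f`, then this maps `(f, h)` to `x_b f` and its
derivatives according to the Leibniz rule `∂^a (x_b f) = δ^a_b f + X^{ad}_{cb} x_d ∂^c f`. -/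
def leibniz {B : Type*} [Ring B] [Algebra ℂ B] (x : Fin 4 → B)
    (X : Fin 4 → Fin 4 → Fin 4 → Fin 4 → ℂ) (b : Fin 4) : Module.End ℂ (B × (Fin 4 → B)) where
  toFun p := (x b * p.1, fun a =>
    (if a = b then p.1 else 0) + ∑ c, ∑ d, X a d c b • (x d * p.2 c))
  map_add' p s := by
    ext a
    · simp [mul_add]
    · simp only [Prod.fst_add, Prod.snd_add, Pi.add_apply, mul_add, smul_add,
        Finset.sum_add_distrib]
      split_ifs <;> abel
  map_smul' r p := by
    ext a
    · simp
    · simp only [Prod.smul_fst, Prod.smul_snd, Pi.smul_apply, mul_smul_comm, RingHom.id_apply,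
        smul_add, Finset.smul_sum, smul_comm r]
      split_ifs <;> simp

theorem sum_rot3 {B : Type*} [AddCommMonoid B] (G : Fin 4 → Fin 4 → Fin 4 → B) :
    ∑ u, ∑ v, ∑ c, G u v c = ∑ c, ∑ u, ∑ v, G u v c := by
  rw [Finset.sum_congr rfl fun u _ => Finset.sum_comm (f := G u), Finset.sum_comm]

theorem leibniz_leibniz {B : Type*} [Ring B] [Algebra ℂ B] (x : Fin 4 → B)
    (X : Fin 4 → Fin 4 → Fin 4 → Fin 4 → ℂ) (a b e : Fin 4) (f : B) (h : Fin 4 → B) :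
    ((leibniz x X a * leibniz x X b) (f, h)).2 e =
      ∑ d, ((if e = a ∧ d = b then 1 else 0) + X e d b a) • (x d * f) +
        ∑ c, ∑ d, ∑ k, (∑ g, X e d g a * X g k c b) • (x d * x k * h c) := by
  have e1 : ∀ g d : Fin 4, X e d g a • (x d * ((if g = b then f else 0) +
      ∑ c, ∑ k, X g k c b • (x k * h c))) =
      (if g = b then X e d g a • (x d * f) else 0) +
      ∑ c, ∑ k, (X e d g a * X g k c b) • (x d * x k * h c) := by
    intro g d
    simp only [mul_add, Finset.mul_sum, mul_smul_comm, smul_add, Finset.smul_sum, smul_smul,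
      mul_assoc]
    congr 1
    split_ifs <;> simp
  simp only [Module.End.mul_apply, leibniz, LinearMap.coe_mk, AddHom.coe_mk, e1,
    Finset.sum_add_distrib, add_smul, Finset.sum_smul]
  rw [add_assoc]
  congr 1
  · by_cases hea : e = a <;> simp [hea]
  · congr 1
    · rw [Finset.sum_comm]
      simp
    · calc _ = ∑ c, ∑ g, ∑ d, ∑ k, (X e d g a * X g k c b) • (x d * x k * h c) :=
          sum_rot3 _
        _ = _ := Finset.sum_congr rfl fun c _ => by
            rw [Finset.sum_comm]
            refine Finset.sum_congr rfl fun d _ => ?_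
            rw [Finset.sum_comm]

theorem leibniz_comm {B : Type*} [Ring B] [Algebra ℂ B] (x : Fin 4 → B)
    (X M : Fin 4 → Fin 4 → Fin 4 → Fin 4 → ℂ)
    (hx : ∀ a b, x a * x b = ∑ c, ∑ d, M c d a b • (x d * x c))
    (h1 : ∀ a b e d, (if e = a ∧ d = b then 1 else 0) + X e d b a =
      M d e a b + ∑ u, ∑ v, M u v a b * X e d u v)
    (h2 : ∀ a b e c d f, ∑ u, ∑ v, M u v a b * ∑ g, X e d g v * X g f c u =
      ∑ u, ∑ v, M f d u v * ∑ g, X e u g a * X g v c b) (a b : Fin 4) :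
    leibniz x X a * leibniz x X b = ∑ c, ∑ d, M c d a b • (leibniz x X d * leibniz x X c) := by
  refine LinearMap.ext fun p => ?_
  obtain ⟨f, h⟩ := p
  refine Prod.ext ?_ ?_
  · simp only [LinearMap.sum_apply, LinearMap.smul_apply, Module.End.mul_apply, Prod.fst_sum,
      Prod.smul_fst]
    simp only [leibniz, LinearMap.coe_mk, AddHom.coe_mk, ← mul_assoc, hx a b,
      Finset.sum_mul, smul_mul_assoc]
  · funext e
    have e2 : ((∑ c, ∑ d, M c d a b • (leibniz x X d * leibniz x X c)) (f, h)).2 e =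
        ∑ u, ∑ v, M u v a b • ((leibniz x X v * leibniz x X u) (f, h)).2 e := by
      simp only [LinearMap.sum_apply, LinearMap.smul_apply, Prod.snd_sum, Prod.smul_snd,
        Finset.sum_apply, Pi.smul_apply]
    rw [e2]
    simp only [leibniz_leibniz, smul_add, Finset.sum_add_distrib]
    congr 1
    · simp only [Finset.smul_sum, smul_smul]
      rw [sum_rot3]
      refine Finset.sum_congr rfl fun d _ => ?_
      simp only [← Finset.sum_smul]
      congr 1
      rw [h1]
      simp only [mul_add, Finset.sum_add_distrib]
      congr 1
      rw [Finset.sum_eq_single d, Finset.sum_eq_single e] <;> simp +contextual [eq_comm]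
    · simp only [Finset.smul_sum, smul_smul]
      refine Eq.trans ?_ (sum_rot3 _).symm
      refine Finset.sum_congr rfl fun c _ => ?_
      have e3 : ∀ (r : ℂ) (u v : Fin 4), r • (x u * x v * h c) =
          ∑ k, ∑ d, (M k d u v * r) • (x d * x k * h c) := by
        intro r u v
        rw [hx u v]
        simp only [Finset.sum_mul, smul_mul_assoc, Finset.smul_sum, smul_smul, mul_comm]
      calc ∑ u, ∑ v, (∑ g, X e u g a * X g v c b) • (x u * x v * h c)
          = ∑ u, ∑ v, ∑ k, ∑ d, (M k d u v * ∑ g, X e u g a * X g v c b) • (x d * x k * h c) :=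
            Finset.sum_congr rfl fun u _ => Finset.sum_congr rfl fun v _ => e3 _ u v
        _ = ∑ d, ∑ k, ∑ u, ∑ v, (M k d u v * ∑ g, X e u g a * X g v c b) • (x d * x k * h c) := by
            rw [sum_rot3, Finset.sum_congr rfl fun k _ => sum_rot3 _, Finset.sum_comm]
        _ = ∑ d, ∑ k, ∑ u, ∑ v, (M u v a b * ∑ g, X e d g v * X g k c u) • (x d * x k * h c) := by
            refine Finset.sum_congr rfl fun d _ => Finset.sum_congr rfl fun k _ => ?_
            have := congrArg (fun r : ℂ => r • (x d * x k * h c)) (h2 a b e c d k)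
            simp only [Finset.sum_smul] at this
            exact this.symm
        _ = _ := by
            refine Eq.trans ?_ (sum_rot3 _).symm
            exact Finset.sum_congr rfl fun d _ => (sum_rot3 _).symm

/-- The left action of q-Minkowski space on elements together with their derivatives. -/
def prolong {q : ℝ} (hq : q ≠ 0) : Mq q →ₐ[ℂ] Module.End ℂ (Mq q × (Fin 4 → Mq q)) :=
  RingQuot.liftAlgHom ℂ ⟨FreeAlgebra.lift ℂ (leibniz (x q) (RLinv q)), by
    rintro _ _ ⟨a, b⟩
    simpa using leibniz_comm (x q) (RLinv q) (RM q) (x_mul_x q) (rel_one hq) (rel_two hq) a b⟩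

/-- The braided differential operators `∂^a` on q-Minkowski space. -/
def del {q : ℝ} (hq : q ≠ 0) (a : Fin 4) : Mq q →ₗ[ℂ] Mq q where
  toFun f := (prolong hq f (1, 0)).2 a
  map_add' f g := by simp
  map_smul' r f := by simp

theorem del_one {q : ℝ} (hq : q ≠ 0) (a : Fin 4) : del hq a 1 = 0 := by
  simp [del]

theorem prolong_x {q : ℝ} (hq : q ≠ 0) (b : Fin 4) : prolong hq (x q b) = leibniz (x q) (RLinv q) b := by
  simp [prolong, x]

theorem prolong_fst {q : ℝ} (hq : q ≠ 0) (f : Mq q) (p : Mq q × (Fin 4 → Mq q)) :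
    (prolong hq f p).1 = f * p.1 := by
  obtain ⟨f, rfl⟩ := RingQuot.mkAlgHom_surjective ℂ (Rel q) f
  induction f using FreeAlgebra.induction generalizing p with
  | grade0 r => simp [Algebra.algebraMap_eq_smul_one]
  | grade1 a =>
    change (prolong hq (x q a) p).1 = x q a * p.1
    rw [prolong_x]; rfl
  | mul f g hf hg => simp only [map_mul, Module.End.mul_apply, hf, hg, mul_assoc]
  | add f g hf hg => simp only [map_add, LinearMap.add_apply, Prod.fst_add, hf, hg, add_mul]

/-- The braided Leibniz rule, which together with `del_one` determines the operators `∂^a`. -/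
theorem del_x_mul {q : ℝ} (hq : q ≠ 0) (a b : Fin 4) (f : Mq q) :
    del hq a (x q b * f) =
      (if a = b then f else 0) + ∑ c, ∑ d, RLinv q a d c b • (x q d * del hq c f) := by
  change (prolong hq (x q b * f) (1, 0)).2 a = _
  rw [map_mul, Module.End.mul_apply, prolong_x]
  change (if a = b then (prolong hq f (1, 0)).1 else 0) + _ = _
  rw [prolong_fst, mul_one]
  rfl

/-- `∂_a = g_{ab} ∂^b`. -/
def delLow {q : ℝ} (hq : q ≠ 0) (κ : ℝ) (a : Fin 4) : Mq q →ₗ[ℂ] Mq q :=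
  ∑ b, gLow q κ a b • del hq b

/-- The q-d'Alembert operator `□ = ∂_a ∂_b g^{ab}`. -/
def box {q : ℝ} (hq : q ≠ 0) (κ : ℝ) : Mq q →ₗ[ℂ] Mq q :=
  ∑ a, ∑ b, gUp q κ a b • (delLow hq κ a ∘ₗ delLow hq κ b)

/-! ## The q-antisymmetric tensor and the q-antisymmetrisers -/

/-- Lists `a_1 … a_n` of indices. -/
abbrev Idx (n : ℕ) : Type := Fin n → Fin 4

/-- The non-zero components of the totally q-antisymmetric tensor `ε_{abcd}` with `ε_{1234} = 1`,
in terms of the multi-indices numbered from 1 to 4. -/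
def epsTable (q : ℂ) : List (ℕ × ℂ) :=
  [ (1234, 1), (1243, -(q ^ 2)⁻¹), (1324, -1), (1342, q ^ 2), (1414, 1 - q ^ 2), (1423, 1),
    (1432, -1), (1444, 1 - (q ^ 2)⁻¹), (2134, -1), (2143, (q ^ 2)⁻¹), (2314, 1), (2341, -1),
    (2413, -(q ^ 2)⁻¹), (2431, (q ^ 2)⁻¹), (2434, (q ^ 2)⁻¹ - 1), (3124, 1), (3142, -q ^ 2),
    (3214, -1), (3241, 1), (3412, q ^ 2), (3421, -q ^ 2), (3424, 1 - q ^ 2), (4123, -1),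
    (4132, 1), (4141, q ^ 2 - 1), (4144, (q ^ 2)⁻¹ - 1), (4213, 1), (4231, -1),
    (4243, 1 - (q ^ 2)⁻¹), (4312, -1), (4321, 1), (4342, q ^ 2 - 1), (4414, 1 - (q ^ 2)⁻¹),
    (4441, (q ^ 2)⁻¹ - 1)]

/-- The component `ε_{abcd}`. -/
def epsVal (q : ℂ) (a b c d : Fin 4) : ℂ :=
  ((epsTable q).lookup (1000 * ((a : ℕ) + 1) + 100 * (b + 1) + 10 * (c + 1) + (d + 1))).getD 0

/-- The totally q-antisymmetric tensor as a function of a list of four indices. -/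
def eps (q : ℝ) (a : Idx 4) : ℂ := epsVal q (a 0) (a 1) (a 2) (a 3)

/-- The non-zero components of `q² ε`. -/
def pEpsTable : List (ℕ × List ℤ) :=
  [ (1234, [0, 0, 1]), (1243, [-1]), (1324, [0, 0, -1]), (1342, [0, 0, 0, 0, 1]),
    (1414, [0, 0, 1, 0, -1]), (1423, [0, 0, 1]), (1432, [0, 0, -1]), (1444, [-1, 0, 1]),
    (2134, [0, 0, -1]), (2143, [1]), (2314, [0, 0, 1]), (2341, [0, 0, -1]), (2413, [-1]),
    (2431, [1]), (2434, [1, 0, -1]), (3124, [0, 0, 1]), (3142, [0, 0, 0, 0, -1]),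
    (3214, [0, 0, -1]), (3241, [0, 0, 1]), (3412, [0, 0, 0, 0, 1]), (3421, [0, 0, 0, 0, -1]),
    (3424, [0, 0, 1, 0, -1]), (4123, [0, 0, -1]), (4132, [0, 0, 1]), (4141, [0, 0, -1, 0, 1]),
    (4144, [1, 0, -1]), (4213, [0, 0, 1]), (4231, [0, 0, -1]), (4243, [-1, 0, 1]),
    (4312, [0, 0, -1]), (4321, [0, 0, 1]), (4342, [0, 0, -1, 0, 1]), (4414, [-1, 0, 1]),
    (4441, [1, 0, -1])]

/-- The entries of `q² ε`. -/
def pEps : ℕ → ℕ → ℕ → ℕ → List ℤ := look4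
   [[[], [[], [], [[], [], [], [0, 0, 1]], [[], [], [-1]]], [[], [[], [], [], [0, 0, -1]], [], [[],
      [0, 0, 0, 0, 1]]], [[[], [], [], [0, 0, 1, 0, -1]], [[], [], [0, 0, 1]], [[], [0, 0,
      -1]], [[], [], [], [-1, 0, 1]]]],
    [[[], [], [[], [], [], [0, 0, -1]], [[], [], [1]]], [], [[[], [], [], [0, 0, 1]], [], [],
      [[0, 0, -1]]], [[[], [], [-1]], [], [[1], [], [], [1, 0, -1]]]],
    [[[], [[], [], [], [0, 0, 1]], [], [[], [0, 0, 0, 0, -1]]], [[[], [], [], [0, 0, -1]], [],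
      [], [[0, 0, 1]]], [], [[[], [0, 0, 0, 0, 1]], [[0, 0, 0, 0, -1], [], [], [0, 0, 1, 0,
      -1]]]],
    [[[], [[], [], [0, 0, -1]], [[], [0, 0, 1]], [[0, 0, -1, 0, 1], [], [], [1, 0, -1]]], [[[],
      [], [0, 0, 1]], [], [[0, 0, -1]], [[], [], [-1, 0, 1]]], [[[], [0, 0, -1]], [[0, 0, 1]],
      [], [[], [0, 0, -1, 0, 1]]], [[[], [], [], [-1, 0, 1]], [], [], [[1, 0, -1]]]]]

/-- The indices `m_1 … m_j a_1 … a_k` as a list of four indices, for `j + k = 4`. -/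
def cat {j k : ℕ} (m : Idx j) (a : Idx k) : Idx 4 := fun i =>
  if h : (i : ℕ) < j then m ⟨i, h⟩ else if h' : (i : ℕ) - j < k then a ⟨i - j, h'⟩ else 0

/-- `ε^{abcd} = ε_{ijkl} g^{ia} g^{jb} g^{kc} g^{ld}`. -/
def epsUp (q κ : ℝ) (a : Idx 4) : ℂ := ∑ i : Idx 4, eps q i * ∏ s, gUp q κ (i s) (a s)

/-- The normalisation factors `n_k`, with `n_0 = n_4`. -/
def nrm (q : ℝ) : ℕ → ℝ
  | 0 => (q ^ 2)⁻¹ * (2 * (1 + q ^ 2 + q ^ 4) * (1 + q ^ 2) * (1 + q ^ 2))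
  | 1 => 2 * (1 + q ^ 2 + q ^ 4)
  | 2 => (1 + q ^ 2) * (1 + q ^ 2)
  | 3 => 2 * (1 + q ^ 2 + q ^ 4)
  | 4 => (q ^ 2)⁻¹ * (2 * (1 + q ^ 2 + q ^ 4) * (1 + q ^ 2) * (1 + q ^ 2))
  | _ => 0

/-- The q-antisymmetriser `A^{c_1 … c_k}_{a_1 … a_k}`, which is
`(-1)^k / n_k · ε^{m_{4-k} … m_1 c_k … c_1} ε_{m_1 … m_{4-k} a_1 … a_k}` for `k ≤ 4` and zero
otherwise. In the upper `ε` the list `c_1 … c_k m_1 … m_{4-k}` is reversed. -/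
def asym (q κ : ℝ) (k : ℕ) (c a : Idx k) : ℂ :=
  if k ≤ 4 then (-1) ^ k / (nrm q k : ℂ) *
    ∑ m : Idx (4 - k), epsUp q κ (fun i => cat c m i.rev) * eps q (cat m a)
  else 0

/-- A tensor is totally q-antisymmetric if
`T_{… a b …} = - T_{… c d …} (R_L)^{dc}_{ab}` for any two adjacent indices. -/
def QAntisymm (q : ℝ) {n : ℕ} {V : Type*} [AddCommGroup V] [Module ℂ V] (T : Idx n → V) : Prop :=
  ∀ i j : Fin n, (i : ℕ) + 1 = j → ∀ a : Idx n, T a =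
    -∑ c, ∑ d, RL q d c (a i) (a j) • T (Function.update (Function.update a i c) j d)

theorem lookup_map {α β : Type} (f : α → β) (k : ℕ) (l : List (ℕ × α)) :
    (l.map fun e => (e.1, f e.2)).lookup k = (l.lookup k).map f := by
  induction l with
  | nil => rfl
  | cons e l ih =>
    cases h : k == e.1 <;> simp [List.lookup, h, ih]

theorem epsTable_eq {q : ℂ} (hq : q ≠ 0) :
    epsTable q = pEpsTable.map fun e => (e.1, (q ^ 2)⁻¹ * ev q e.2) := by
  have hh : (q ^ 2)⁻¹ * q ^ 2 = 1 := inv_mul_cancel₀ (pow_ne_zero 2 hq)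
  simp only [epsTable, pEpsTable, List.map_cons, List.map_nil, ev]
  push_cast
  repeat' apply congrArg₂ List.cons
  all_goals first
    | rfl
    | (refine congrArg (Prod.mk _) ?_
       first
       | linear_combination -hh
       | linear_combination hh
       | linear_combination (-q ^ 2) * hh
       | linear_combination (q ^ 2) * hh
       | linear_combination (1 - q ^ 2) * hh
       | linear_combination (q ^ 2 - 1) * hh
       | linear_combination (0 : ℂ) * hh)

theorem pEps_cert : (all4 fun a => all4 fun b => all4 fun c => all4 fun d => peq
    ((pEpsTable.lookup (1000 * (a + 1) + 100 * (b + 1) + 10 * (c + 1) + (d + 1))).getD [])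
    (pEps a b c d)) = true := by
  decide +kernel

theorem epsVal_eq {q : ℝ} (hq : q ≠ 0) (a b c d : Fin 4) :
    (q : ℂ) ^ 2 * epsVal q a b c d = ev q (pEps a b c d) := by
  have h : (q : ℂ) ≠ 0 := by exact_mod_cast hq
  rw [← ev_peq (q : ℂ) (all4_apply (all4_apply (all4_apply (all4_apply pEps_cert a) b) c) d),
    epsVal, epsTable_eq h, lookup_map fun p => ((q : ℂ) ^ 2)⁻¹ * ev q p]
  cases pEpsTable.lookup _ with
  | none => simp [ev]
  | some p => simp [h]

theorem eps_cert : (all4 fun a => all4 fun b => all4 fun e => all4 fun f =>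
      peq (0 :: 0 :: 0 :: 0 :: pEps a b e f)
        (psmul (-1) (psum4 fun c => psum4 fun d => pmul (pRL d c a b) (pEps c d e f))) &&
      (peq (0 :: 0 :: 0 :: 0 :: pEps e a b f)
        (psmul (-1) (psum4 fun c => psum4 fun d => pmul (pRL d c a b) (pEps e c d f))) &&
      peq (0 :: 0 :: 0 :: 0 :: pEps e f a b)
        (psmul (-1) (psum4 fun c => psum4 fun d => pmul (pRL d c a b) (pEps e f c d))))) =
    true := by
  decide +kernel

/-- The tensor `ε_{abcd}` is totally q-antisymmetric. -/
theorem eps_qAntisymm {q : ℝ} (hq : q ≠ 0) : QAntisymm q (eps q) := by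
  have h : (q : ℂ) ≠ 0 := by exact_mod_cast hq
  have fin : ∀ (x : ℂ) (F : Fin 4 → Fin 4 → ℂ) (Y : Fin 4 → Fin 4 → ℂ),
      0 + q * (0 + q * (0 + q * (0 + q * (q ^ 2 * x)))) =
        -1 * ∑ c : Fin 4, ∑ d : Fin 4, (q : ℂ) ^ 4 * F c d * (q ^ 2 * Y c d) →
      x = -∑ c : Fin 4, ∑ d : Fin 4, F c d • Y c d := by
    intro x F Y e
    apply mul_left_cancel₀ (pow_ne_zero 6 h)
    have : ∑ c : Fin 4, ∑ d : Fin 4, (q : ℂ) ^ 4 * F c d * (q ^ 2 * Y c d) =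
        q ^ 6 * ∑ c : Fin 4, ∑ d : Fin 4, F c d • Y c d := by
      simp only [smul_eq_mul, Finset.mul_sum]
      refine Finset.sum_congr rfl fun c _ => Finset.sum_congr rfl fun d _ => ?_
      ring
    rw [this] at e
    linear_combination e
  rintro i j hij a
  have cert := fun a b e f => all4_apply (all4_apply (all4_apply (all4_apply eps_cert a) b) e) f
  simp only [Bool.and_eq_true] at cert
  have hi : (i = 0 ∧ j = 1) ∨ (i = 1 ∧ j = 2) ∨ (i = 2 ∧ j = 3) := by
    simp only [Fin.ext_iff]; simp; omega
  obtain ⟨rfl, rfl⟩ | ⟨rfl, rfl⟩ | ⟨rfl, rfl⟩ := hi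
  · have := ev_peq (q : ℂ) (cert (a 0) (a 1) (a 2) (a 3)).1
    simp only [ev_psum4, ev_pmul, ev_psmul, ev, ← RL_eq hq, ← epsVal_eq hq, Int.cast_zero,
      Int.cast_neg, Int.cast_one] at this
    exact fin _ _ _ this
  · have := ev_peq (q : ℂ) (cert (a 1) (a 2) (a 0) (a 3)).2.1
    simp only [ev_psum4, ev_pmul, ev_psmul, ev, ← RL_eq hq, ← epsVal_eq hq, Int.cast_zero,
      Int.cast_neg, Int.cast_one] at this
    exact fin _ _ _ this
  · have := ev_peq (q : ℂ) (cert (a 2) (a 3) (a 0) (a 1)).2.2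
    simp only [ev_psum4, ev_pmul, ev_psmul, ev, ← RL_eq hq, ← epsVal_eq hq, Int.cast_zero,
      Int.cast_neg, Int.cast_one] at this
    exact fin _ _ _ this

theorem QAntisymm.comp_linear {q : ℝ} {n : ℕ} {V W : Type*} [AddCommGroup V] [Module ℂ V]
    [AddCommGroup W] [Module ℂ W] {T : Idx n → V} (h : QAntisymm q T) (L : V →ₗ[ℂ] W) :
    QAntisymm q fun a => L (T a) := by
  intro i j hij a
  simp only
  rw [h i j hij a]
  simp only [map_neg, map_sum, map_smul]

theorem QAntisymm.sum {q : ℝ} {n : ℕ} {V ι : Type*} [Fintype ι] [AddCommGroup V] [Module ℂ V]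
    {T : ι → Idx n → V} (h : ∀ s, QAntisymm q (T s)) : QAntisymm q fun a => ∑ s, T s a := by
  intro i j hij a
  simp only [Finset.smul_sum]
  rw [Finset.sum_congr rfl fun s _ => h s i j hij a, Finset.sum_neg_distrib, neg_inj,
    Finset.sum_comm]
  exact Finset.sum_congr rfl fun c _ => Finset.sum_comm

theorem cat_update_right {j k : ℕ} (hjk : j + k = 4) (m : Idx j) (a : Idx k) (i : Fin k)
    (c : Fin 4) : cat m (Function.update a i c) =
      Function.update (cat m a) (Fin.cast hjk (Fin.natAdd j i)) c := by
  funext s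
  by_cases hs : s = Fin.cast hjk (Fin.natAdd j i)
  · subst hs
    simp [cat]
  · have hs' : (s : ℕ) ≠ j + i := fun e => hs (Fin.ext (by simpa using e))
    rw [Function.update_of_ne hs]
    simp only [cat]
    split_ifs with h1 h2
    · rfl
    · rw [Function.update_of_ne]
      intro e
      have := congrArg Fin.val e
      simp only at this
      omega
    · rfl

theorem cat_update_left {j k : ℕ} (hjk : j + k = 4) (m : Idx j) (a : Idx k) (i : Fin j)
    (c : Fin 4) : cat (Function.update m i c) a =
      Function.update (cat m a) (Fin.cast hjk (Fin.castAdd k i)) c := by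
  funext s
  by_cases hs : s = Fin.cast hjk (Fin.castAdd k i)
  · subst hs
    simp [cat]
  · have hs' : (s : ℕ) ≠ i := fun e => hs (Fin.ext (by simpa using e))
    rw [Function.update_of_ne hs]
    simp only [cat]
    split_ifs with h1 h2
    · rw [Function.update_of_ne]
      intro e
      exact hs' (congrArg Fin.val e)
    · rfl
    · rfl

theorem eps_cat_right {q : ℝ} (hq : q ≠ 0) {j k : ℕ} (hjk : j + k = 4) (m : Idx j) :
    QAntisymm q fun a : Idx k => eps q (cat m a) := by
  intro i i' hi a
  have := eps_qAntisymm hq (Fin.cast hjk (Fin.natAdd j i)) (Fin.cast hjk (Fin.natAdd j i'))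
    (by simp; omega) (cat m a)
  have e : ∀ i : Fin k, cat m a (Fin.cast hjk (Fin.natAdd j i)) = a i := fun i => by simp [cat]
  simpa only [e, ← cat_update_right hjk] using this

theorem eps_cat_left {q : ℝ} (hq : q ≠ 0) {j k : ℕ} (hjk : j + k = 4) (b : Idx k) :
    QAntisymm q fun a : Idx j => eps q (cat a b) := by
  intro i i' hi a
  have := eps_qAntisymm hq (Fin.cast hjk (Fin.castAdd k i)) (Fin.cast hjk (Fin.castAdd k i'))
    (by simpa using hi) (cat a b)
  have e : ∀ i : Fin j, cat a b (Fin.cast hjk (Fin.castAdd k i)) = a i := fun i => by simp [cat]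
  simpa only [e, ← cat_update_left hjk] using this

theorem asym_qAntisymm {q : ℝ} (hq : q ≠ 0) (κ : ℝ) (k : ℕ) (c : Idx k) :
    QAntisymm q (asym q κ k c) := by
  by_cases hk : k ≤ 4
  · have h1 : asym q κ k c = fun a => ∑ m : Idx (4 - k),
        ((-1) ^ k / (nrm q k : ℂ) * epsUp q κ (fun i => cat c m i.rev)) • eps q (cat m a) := by
      funext a
      rw [asym, if_pos hk, Finset.mul_sum]
      simp only [smul_eq_mul, mul_assoc]
    rw [h1]
    exact QAntisymm.sum fun m =>
      (eps_cat_right hq (by omega) m).comp_linear (LinearMap.lsmul ℂ ℂ _)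
  · have h1 : asym q κ k c = fun _ => 0 := by
      funext a
      rw [asym, if_neg hk]
    rw [h1]
    intro i j _ a
    simp

/-! ## Forms -/

/-- The space `Ω_p` of `p`-forms on q-Minkowski space. The `dx_{a_1} ∧ … ∧ dx_{a_p} = e_{a_1 … a_p}`
span the space `Λ_p` and are totally q-antisymmetric, so that a linear map `w : Λ_p → M_q` is
given by the totally q-antisymmetric family of its values `w(e_{a_1 … a_p}) ∈ M_q`. -/
def Form (q : ℝ) (p : ℕ) : Submodule ℂ (Idx p → Mq q) where
  carrier := {w | QAntisymm q w}
  add_mem' {v w} hv hw := by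
    intro i j hij a
    simp only [Pi.add_apply, smul_add, Finset.sum_add_distrib, neg_add]
    rw [hv i j hij a, hw i j hij a]
  zero_mem' := by intro i j _ a; simp
  smul_mem' r w hw := hw.comp_linear (LinearMap.lsmul ℂ (Mq q) r)

/-- The 1-form with `A(e_z) = A_z`; the `A_z` can be any elements of `M_q`. -/
def oneForm {q : ℝ} (A : Fin 4 → Mq q) : Form q 1 :=
  ⟨fun a => A (a 0), fun i j h => by omega⟩

/-- The q-exterior derivative `dw(e_{a_1 … a_{p+1}}) = ∂_{[a_1} w_{a_2 … a_{p+1}]}`. -/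
def extDeriv {q : ℝ} (hq : q ≠ 0) (κ : ℝ) {p : ℕ} (w : Form q p) : Form q (p + 1) :=
  ⟨fun a => ∑ b : Idx (p + 1), asym q κ (p + 1) b a • delLow hq κ (b 0) (w.1 (Fin.tail b)),
    QAntisymm.sum fun b =>
      (asym_qAntisymm hq κ (p + 1) b).comp_linear (LinearMap.toSpanSingleton ℂ (Mq q) _)⟩

/-- The q-Hodge star operator
`*w(e_{a_1 … a_{4-p}}) = n_p^{-1/2} ε_{a_1 … a_{4-p} b_1 … b_p} g^{b_1 c_p} … g^{b_p c_1} w_{c_1 … c_p}`,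
for `p ≤ 4`. -/
def hodge {q : ℝ} (hq : q ≠ 0) (κ : ℝ) {p : ℕ} (w : Form q p) : Form q (4 - p) :=
  ⟨fun a => ∑ b : Idx p, ∑ c : Idx p,
      ((((Real.sqrt (nrm q p))⁻¹ : ℝ) : ℂ) * eps q (cat a b) * ∏ s, gUp q κ (b s) (c s.rev)) •
        w.1 c, by
    by_cases hp : p ≤ 4
    · refine QAntisymm.sum fun b => QAntisymm.sum fun c => ?_
      have := (eps_cat_left hq (by omega : 4 - p + p = 4) b).comp_linear
        ((LinearMap.toSpanSingleton ℂ (Mq q) (w.1 c)).comp (LinearMap.lsmul ℂ ℂ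
          ((((Real.sqrt (nrm q p))⁻¹ : ℝ) : ℂ) * ∏ s, gUp q κ (b s) (c s.rev))))
      convert this using 2 with a
      simp only [LinearMap.comp_apply, LinearMap.lsmul_apply, LinearMap.toSpanSingleton_apply,
        smul_eq_mul]
      congr 1
      ring
    · intro i
      exact absurd i.2 (by omega)⟩

/-- The q-coderivative `δ = * d *`. On `p`-forms with `1 ≤ p ≤ 4` the degree of the result is
`4 - (4 - p + 1) = p - 1`. -/
def coderiv {q : ℝ} (hq : q ≠ 0) (κ : ℝ) {p : ℕ} (w : Form q p) : Form q (4 - (4 - p + 1)) :=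
  hodge hq κ (extDeriv hq κ (hodge hq κ w))

/-- The components `A_z = A(e_z)` of a 1-form. -/
def comp {q : ℝ} (A : Form q 1) (z : Fin 4) : Mq q := A.1 ![z]

/-- The q-antisymmetrised derivative `∂_{[c} A_{z]} = ∂_a A_b A^{ab}_{cz}` of a 1-form. -/
def curl {q : ℝ} (hq : q ≠ 0) (κ : ℝ) (A : Form q 1) (c z : Fin 4) : Mq q :=
  ∑ a, ∑ b, asym q κ 2 ![a, b] ![c, z] • delLow hq κ a (comp A b)

end QMinkowski

end

namespace QMinkowski

noncomputable section

/-! ## Scaled polynomial representations -/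

/-! Each exterior derivative in `*d*dA` brings in an antisymmetriser, of two indices for `dA` and of
three for `d*dA`, and each is followed by a Hodge star. The star kernels are built from the
q-antisymmetric ε and absorb these antisymmetrisers (`starTwo_epsTwo`, `starThree_epsThree`). What
remains of `(δdA)_z` is the product of the two star kernels contracted with `∂_d ∂_f A_h`. This
product is again a two-index antisymmetriser with one index raised (`starThree_starTwo`), so
`(δdA)_z` is a nonzero multiple of `∂^c ∂_[c A_z]` (`coderiv_extDeriv`). This gives the first
equivalence and uses no relation between the derivatives.

The second equivalence needs the relations `∂^a ∂^b = R_M^{ab}_{cd} ∂^d ∂^c` (`del_del`). They hold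
at 1 and persist under left multiplication by a generator, by the twofold Leibniz rule and a mixed
Yang-Baxter equation. Write them as `∂∂ = M ∂∂` with `M^{kl}_{ij} = R_M^{kl}_{ji}`. For κ = 1 the
expression `n_2 ∂^c ∂_[c A_z] - 2q² (□A_z - ∂_z ∂^c A_c)` is `D_{ij} ∂^i ∂^j A_h`, summed over h, i,
j, with D = `maxwellDiff`. The rows D satisfy `D (M + q²)(q² M + 1) = 0`. As 1 is not a root of this
polynomial, D is a multiple of `1 - M` and annihilates the second derivatives (`maxwellDiff_eq`,
`maxwellDiff_del_del`). Hence the two second-order operators are proportional, with a nonzero factor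
(`maxwellDiff_apply`).

The tensor identities are finite families of identities between Laurent polynomials in q with
integer coefficients. Multiplied by a power of q they become equalities of coefficient lists,
checked for all indices, which settles all real q ≠ 0 at once. -/

/-- `q ^ s * z` is the value at `q` of the polynomial with coefficient list `p`. -/
def Rep (q : ℂ) (s : ℕ) (z : ℂ) (p : List ℤ) : Prop := q ^ s * z = ev q p

theorem Rep.mul {q : ℂ} {s t : ℕ} {z w : ℂ} {p r : List ℤ} (h : Rep q s z p) (h' : Rep q t w r) :
    Rep q (t + s) (z * w) (pmul p r) := by
  unfold Rep at *
  rw [ev_pmul, ← h, ← h']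
  ring

theorem Rep.add {q : ℂ} {s : ℕ} {z w : ℂ} {p r : List ℤ} (h : Rep q s z p) (h' : Rep q s w r) :
    Rep q s (z + w) (padd p r) := by
  unfold Rep at *
  rw [ev_padd, ← h, ← h']
  ring

theorem Rep.neg {q : ℂ} {s : ℕ} {z : ℂ} {p : List ℤ} (h : Rep q s z p) :
    Rep q s (-z) (psmul (-1) p) := by
  unfold Rep at *
  rw [ev_psmul, ← h]
  push_cast
  ring

theorem Rep.sub {q : ℂ} {s : ℕ} {z w : ℂ} {p r : List ℤ} (h : Rep q s z p) (h' : Rep q s w r) :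
    Rep q s (z - w) (padd p (psmul (-1) r)) := by
  rw [sub_eq_add_neg]
  exact h.add h'.neg

theorem Rep.sum {q : ℂ} {s : ℕ} {z : Fin 4 → ℂ} {p : ℕ → List ℤ} (h : ∀ i : Fin 4, Rep q s (z i) (p i)) :
    Rep q s (∑ i, z i) (psum4 p) := by
  unfold Rep at *
  rw [ev_psum4, Finset.mul_sum]
  exact Finset.sum_congr rfl fun i _ => h i

/-- Multiplication of a polynomial by `q ^ n`. -/
def pshift (n : ℕ) (p : List ℤ) : List ℤ :=
  Nat.rec (motive := fun _ => List ℤ) p (fun _ l => 0 :: l) n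

/-- Brings the two sides of an identity to a common power of q, as `Rep.eq` requires. -/
theorem Rep.shift {q : ℂ} {s : ℕ} {z : ℂ} {p : List ℤ} (h : Rep q s z p) (n : ℕ) :
    Rep q (s + n) z (pshift n p) := by
  induction n with
  | zero => exact h
  | succ n ih =>
    change _ = ev q (0 :: pshift n p)
    unfold Rep at ih
    rw [ev, ← ih]
    push_cast
    ring

/-- Reduces an identity of scalars to a comparison of integer lists; q ≠ 0 allows the power of q to
be cancelled. -/
theorem Rep.eq {q : ℂ} (hq : q ≠ 0) {s : ℕ} {z w : ℂ} {p r : List ℤ} (h : Rep q s z p)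
    (h' : Rep q s w r) (hpr : peq p r = true) : z = w := by
  refine mul_left_cancel₀ (pow_ne_zero s hq) ?_
  rw [h, h', ev_peq q hpr]

/-- The Kronecker symbol as a polynomial. -/
def pkron (a b : ℕ) : List ℤ := if a == b then [1] else []

theorem rep_kron (q : ℂ) (a b : Fin 4) : Rep q 0 (if a = b then 1 else 0) (pkron a b) := by
  simp only [Rep, pkron, beq_iff_eq, Fin.val_inj]
  split_ifs <;> simp [ev]

/-! ## The metric -/

/-- The q-metric `g^{ab}` in the normalisation `κ = 1`. -/
def met (q : ℝ) : Fin 4 → Fin 4 → ℂ :=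
  ![![((q : ℂ) ^ 2)⁻¹ - 1, 0, 0, 1], ![0, 0, -1, 0], ![0, -(q : ℂ) ^ 2, 0, 0], ![1, 0, 0, 0]]

/-- The q-metric `g_{ab}` in the normalisation `κ = 1`. -/
def metInv (q : ℝ) : Fin 4 → Fin 4 → ℂ :=
  ![![0, 0, 0, 1], ![0, 0, -1, 0], ![0, -((q : ℂ) ^ 2)⁻¹, 0, 0], ![1, 0, 0, 1 - ((q : ℂ) ^ 2)⁻¹]]

theorem sqrtq_mul_self {q : ℝ} : sqrtq q * sqrtq q = q := by
  rw [sqrtq, ← sq, ← Complex.cpow_nat_mul]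
  simp

/-- Each term contains a product of two entries of the spinor metric, so the square root of q either
cancels or appears squared. The choice of root, and the sign of q, do not matter. -/
theorem gUp_apply {q : ℝ} (hq : q ≠ 0) (κ : ℝ) (a b : Fin 4) : gUp q κ a b = κ * met q a b := by
  have h : (q : ℂ) ≠ 0 := by exact_mod_cast hq
  have hs : sqrtq q ≠ 0 := fun e => h (by rw [← sqrtq_mul_self, e, zero_mul])
  have h2 : sqrtq q ^ 2 = q := by rw [sq, sqrtq_mul_self]
  simp only [gUp, Matrix.of_apply]
  congr 1
  fin_cases a <;> fin_cases b <;>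
    simp [Fin.sum_univ_two, spinLow, spinUp, R, lft, rgt, met, finProdFinEquiv]
  all_goals (try field_simp)
  all_goals (try rw [h2])
  all_goals ring

theorem metInv_mul_met {q : ℝ} (hq : q ≠ 0) (a b : Fin 4) :
    ∑ c, metInv q a c * met q b c = if a = b then 1 else 0 := by
  have h : (q : ℂ) ≠ 0 := by exact_mod_cast hq
  fin_cases a <;> fin_cases b <;> simp [Fin.sum_univ_four, met, metInv, h]

/-- The metric is not symmetric, so contraction over the first indices is recorded separately. It is
the one that turns `∂_e g^{ec}` into `∂^c`. -/
theorem met_mul_metInv {q : ℝ} (hq : q ≠ 0) (a b : Fin 4) :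
    ∑ c, met q c a * metInv q c b = if a = b then 1 else 0 := by
  have h : (q : ℂ) ≠ 0 := by exact_mod_cast hq
  fin_cases a <;> fin_cases b <;> simp [Fin.sum_univ_four, met, metInv, h]

theorem gLow_apply {q κ : ℝ} (hq : q ≠ 0) (hκ : κ ≠ 0) (a b : Fin 4) :
    gLow q κ a b = (κ : ℂ)⁻¹ * metInv q a b := by
  have hk : (κ : ℂ) ≠ 0 := by exact_mod_cast hκ
  have : (Matrix.of fun a b => (κ : ℂ)⁻¹ * metInv q b a) = (gUp q κ)⁻¹ := by
    symm
    apply Matrix.inv_eq_left_inv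
    rw [← Matrix.transpose_inj, Matrix.transpose_mul, Matrix.transpose_one]
    -- Exchanging the two factors turns the product into the contraction over second indices,
    -- `g_{ac} g^{bc}`.
    apply mul_eq_one_comm.mp
    ext a b
    simp only [Matrix.mul_apply, Matrix.transpose_apply, Matrix.of_apply, gUp_apply hq]
    rw [Matrix.one_apply, ← metInv_mul_met hq]
    refine Finset.sum_congr rfl fun c _ => ?_
    field_simp
  rw [gLow, ← this]
  rfl

/-- The entries of `q² g^{ab}`. -/
def pMet (a b : ℕ) : List ℤ :=
  look (look [[[1, 0, -1], [], [], [0, 0, 1]], [[], [], [0, 0, -1]], [[], [0, 0, 0, 0, -1]],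
    [[0, 0, 1]]] a) b

/-- The entries of `q² g_{ab}`. -/
def pMetInv (a b : ℕ) : List ℤ :=
  look (look [[[], [], [], [0, 0, 1]], [[], [], [0, 0, -1]], [[], [-1]],
    [[0, 0, 1], [], [], [-1, 0, 1]]] a) b

theorem rep_met {q : ℝ} (hq : q ≠ 0) (a b : Fin 4) : Rep q 2 (met q a b) (pMet a b) := by
  have h : (q : ℂ) ≠ 0 := by exact_mod_cast hq
  have h2 : (q : ℂ) ^ 2 * ((q : ℂ) ^ 2)⁻¹ = 1 := mul_inv_cancel₀ (pow_ne_zero 2 h)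
  fin_cases a <;> fin_cases b <;> simp [Rep, met, pMet, look, ev, mul_sub, h2]
  all_goals ring

theorem rep_metInv {q : ℝ} (hq : q ≠ 0) (a b : Fin 4) : Rep q 2 (metInv q a b) (pMetInv a b) := by
  have h : (q : ℂ) ≠ 0 := by exact_mod_cast hq
  have h2 : (q : ℂ) ^ 2 * ((q : ℂ) ^ 2)⁻¹ = 1 := mul_inv_cancel₀ (pow_ne_zero 2 h)
  fin_cases a <;> fin_cases b <;> simp [Rep, metInv, pMetInv, look, ev, mul_sub, h2]
  all_goals ring

theorem rep_epsVal {q : ℝ} (hq : q ≠ 0) (a b c d : Fin 4) :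
    Rep q 2 (epsVal q a b c d) (pEps a b c d) :=
  epsVal_eq hq a b c d

/-! ## Contractions of the q-antisymmetric tensor -/

/-- `ε^{abcd}` in the normalisation `κ = 1`. -/
def epsRaised (q : ℝ) (a b c d : Fin 4) : ℂ :=
  ∑ i, met q i a * ∑ j, met q j b * ∑ k, met q k c * ∑ l, met q l d * epsVal q i j k l

def pEpsRaised (a b c d : ℕ) : List ℤ :=
  psum4 fun i => pmul (pMet i a) (psum4 fun j => pmul (pMet j b) (psum4 fun k => pmul (pMet k c)
    (psum4 fun l => pmul (pMet l d) (pEps i j k l))))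

/-- The four metrics and ε each contribute a factor q², whence the exponent 10. -/
theorem rep_epsRaised {q : ℝ} (hq : q ≠ 0) (a b c d : Fin 4) :
    Rep q 10 (epsRaised q a b c d) (pEpsRaised a b c d) :=
  .sum fun i => (rep_met hq i a).mul <| .sum fun j => (rep_met hq j b).mul <|
    .sum fun k => (rep_met hq k c).mul <| .sum fun l => (rep_met hq l d).mul <|
      (rep_epsVal hq i j k l)

/-- The contraction `ε^{nmdc} ε_{mnab}`, which is `n_2` times the q-antisymmetriser of two
indices for `κ = 1`. -/
def epsTwo (q : ℝ) (c d a b : Fin 4) : ℂ :=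
  ∑ m, ∑ n, epsVal q m n a b * epsRaised q n m d c

def pEpsTwo (c d a b : ℕ) : List ℤ :=
  psum4 fun m => psum4 fun n => pmul (pEps m n a b) (pEpsRaised n m d c)

theorem rep_epsTwo {q : ℝ} (hq : q ≠ 0) (c d a b : Fin 4) :
    Rep q 12 (epsTwo q c d a b) (pEpsTwo c d a b) :=
  .sum fun m => .sum fun n => (rep_epsVal hq m n a b).mul (rep_epsRaised hq n m d c)

/-- The kernel `ε_{abij} g^{id} g^{jc}` of the q-Hodge star on 2-forms for `κ = 1`. -/
def starTwo (q : ℝ) (a b c d : Fin 4) : ℂ :=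
  ∑ i, met q i d * ∑ j, met q j c * epsVal q a b i j

def pStarTwo (a b c d : ℕ) : List ℤ :=
  psum4 fun i => pmul (pMet i d) (psum4 fun j => pmul (pMet j c) (pEps a b i j))

theorem rep_starTwo {q : ℝ} (hq : q ≠ 0) (a b c d : Fin 4) :
    Rep q 6 (starTwo q a b c d) (pStarTwo a b c d) :=
  .sum fun i => (rep_met hq i d).mul <| .sum fun j => (rep_met hq j c).mul <|
    (rep_epsVal hq a b i j)

/-- The kernel `ε_{zijk} g^{ic} g^{jb} g^{ka}` of the q-Hodge star on 3-forms for `κ = 1`. -/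
def starThree (q : ℝ) (z a b c : Fin 4) : ℂ :=
  ∑ i, met q i c * ∑ j, met q j b * ∑ k, met q k a * epsVal q z i j k

def pStarThree (z a b c : ℕ) : List ℤ :=
  psum4 fun i => pmul (pMet i c) (psum4 fun j => pmul (pMet j b) (psum4 fun k =>
    pmul (pMet k a) (pEps z i j k)))

theorem rep_starThree {q : ℝ} (hq : q ≠ 0) (z a b c : Fin 4) :
    Rep q 8 (starThree q z a b c) (pStarThree z a b c) :=
  .sum fun i => (rep_met hq i c).mul <| .sum fun j => (rep_met hq j b).mul <|
    .sum fun k => (rep_met hq k a).mul <| (rep_epsVal hq z i j k)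

/-! ### Star kernels against antisymmetrisers and against each other -/

theorem starTwo_cert : (all4 fun a => all4 fun b => all4 fun c => all4 fun d => peq
    (psum4 fun i => psum4 fun j => pmul (pStarTwo a b i j) (pEpsTwo c d i j))
    (pshift 12 (pmul [1, 0, 2, 0, 1] (pStarTwo a b c d)))) = true := by
  decide +kernel

/-- The q-Hodge star on 2-forms does not see the q-antisymmetriser. -/
theorem starTwo_epsTwo {q : ℝ} (hq : q ≠ 0) (a b c d : Fin 4) :
    ∑ i, ∑ j, starTwo q a b i j * epsTwo q c d i j = (nrm q 2 : ℂ) * starTwo q a b c d := by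
  have h : (q : ℂ) ≠ 0 := by exact_mod_cast hq
  -- The list holds the coefficients of `n_2 = (1 + q²)²`.
  have hn : Rep q 0 (nrm q 2 : ℂ) [1, 0, 2, 0, 1] := by
    simp [Rep, nrm, ev]
    ring
  -- The left side carries q^6 from the star and q^12 from `epsTwo`; the right side has only q^6 and
  -- is shifted by 12.
  exact Rep.eq h (s := 18) (.sum fun i => .sum fun j => (rep_starTwo hq a b i j).mul
    (rep_epsTwo hq c d i j)) ((hn.mul (rep_starTwo hq a b c d)).shift 12)
    (all4_apply (all4_apply (all4_apply (all4_apply starTwo_cert a) b) c) d)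

theorem starThree_cert : (all4 fun z => all4 fun m => peq
    (psum4 fun i => psum4 fun j => psum4 fun k => pmul (pStarThree z i j k) (pEps m i j k))
    (pshift 8 (pmul [-2, 0, -2, 0, -2] (pMetInv z m)))) = true := by
  decide +kernel

/-- Contracting two ε over three indices leaves only the metric. With `metInv_epsRaised` this
two-index identity yields `starThree_epsThree`, so no identity with seven indices has to be checked.
-/
theorem starThree_eps {q : ℝ} (hq : q ≠ 0) (z m : Fin 4) :
    ∑ i, ∑ j, ∑ k, starThree q z i j k * epsVal q m i j k = -(nrm q 3 : ℂ) * metInv q z m := by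
  have h : (q : ℂ) ≠ 0 := by exact_mod_cast hq
  have hn : Rep q 0 (-(nrm q 3 : ℂ)) [-2, 0, -2, 0, -2] := by
    simp [Rep, nrm, ev]
    ring
  exact Rep.eq h (s := 10) (.sum fun i => .sum fun j => .sum fun k =>
    (rep_starThree hq z i j k).mul (rep_epsVal hq m i j k))
    ((hn.mul (rep_metInv hq z m)).shift 8) (all4_apply (all4_apply starThree_cert z) m)

/-- Lowering the first index of `ε^{mcba}` undoes one of its four metrics; the other three are those
of the star on 3-forms. -/
theorem metInv_epsRaised {q : ℝ} (hq : q ≠ 0) (z a b c : Fin 4) :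
    ∑ m, metInv q z m * epsRaised q m c b a = starThree q z a b c := by
  have e : ∀ F : Fin 4 → ℂ, ∑ m, metInv q z m * ∑ i, met q i m * F i = F z := by
    intro F
    simp only [Finset.mul_sum, ← mul_assoc]
    rw [Finset.sum_comm]
    simp only [← Finset.sum_mul, metInv_mul_met hq]
    simp
  exact e fun i => ∑ j, met q j c * ∑ k, met q k b * ∑ l, met q l a * epsVal q i j k l

theorem star_star_cert : (all4 fun z => all4 fun e => all4 fun f => all4 fun h => peq
    (psum4 fun a => psum4 fun b => pmul (pStarThree z e a b) (pStarTwo a b f h))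
    (psmul (-1) (psum4 fun c => pmul (pMet e c) (pEpsTwo f h c z)))) = true := by
  decide +kernel

/-- The q-analogue of the contraction of two ε over two indices. With e the index of the outer
derivative, the right side is the kernel of `∂^c ∂_[c A_z]` up to a factor, so this identity makes
`*d*dA` the divergence of the antisymmetrised derivative. -/
theorem starThree_starTwo {q : ℝ} (hq : q ≠ 0) (z e f h : Fin 4) :
    ∑ a, ∑ b, starThree q z e a b * starTwo q a b f h = -∑ c, met q e c * epsTwo q f h c z := by
  have h0 : (q : ℂ) ≠ 0 := by exact_mod_cast hq
  exact Rep.eq h0 (s := 14) (.sum fun a => .sum fun b =>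
    (rep_starThree hq z e a b).mul (rep_starTwo hq a b f h))
    (Rep.sum fun c => (rep_met hq e c).mul (rep_epsTwo hq f h c z)).neg
    (all4_apply (all4_apply (all4_apply (all4_apply star_star_cert z) e) f) h)

/-! ## The commutation relations of the braided derivatives -/

theorem rep_RM {q : ℝ} (hq : q ≠ 0) (a b c d : Fin 4) : Rep q 4 (RM q a b c d) (pRM a b c d) :=
  RM_eq hq a b c d

theorem rep_RLinv {q : ℝ} (hq : q ≠ 0) (a b c d : Fin 4) :
    Rep q 4 (RLinv q a b c d) (pRLinv a b c d) :=
  RLinv_eq hq a b c d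

theorem del_del_one_cert : (all4 fun a => all4 fun b => all4 fun c => all4 fun g => peq
    (pshift 4 (padd (pshift 4 (pmul (pkron b c) (pkron a g))) (pRLinv b a g c)))
    (psum4 fun u => psum4 fun v => pmul (pRM a b u v)
      (padd (pshift 4 (pmul (pkron u c) (pkron v g))) (pRLinv u v g c)))) = true := by
  decide +kernel

/-- Compares the coefficients of `∂^g f` when both sides of the commutation relation are applied to
`x_c f`. -/
theorem del_del_linear {q : ℝ} (hq : q ≠ 0) (a b c g : Fin 4) :
    (if b = c then 1 else 0) * (if a = g then 1 else 0) + RLinv q b a g c =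
      ∑ u, ∑ v, RM q a b u v *
        ((if u = c then 1 else 0) * (if v = g then 1 else 0) + RLinv q u v g c) := by
  have h : (q : ℂ) ≠ 0 := by exact_mod_cast hq
  have e : ∀ u v : Fin 4, Rep q 4
      ((if u = c then 1 else 0) * (if v = g then 1 else 0) + RLinv q u v g c)
      (padd (pshift 4 (pmul (pkron u c) (pkron v g))) (pRLinv u v g c)) := fun u v =>
    (((rep_kron q u c).mul (rep_kron q v g)).shift 4).add (rep_RLinv hq u v g c)
  exact Rep.eq h (s := 8) ((e b a).shift 4)
    (.sum fun u => .sum fun v => (rep_RM hq a b u v).mul (e u v))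
    (all4_apply (all4_apply (all4_apply (all4_apply del_del_one_cert a) b) c) g)

/-- The coefficient of `x_h ∂^k ∂^g f` in `∂^a ∂^b (x_c f)`. -/
def delCoeff (q : ℝ) (a b c h k g : Fin 4) : ℂ := ∑ e, RLinv q b e g c * RLinv q a h k e

def pDelCoeff (a b c h k g : ℕ) : List ℤ := psum4 fun e => pmul (pRLinv b e g c) (pRLinv a h k e)

theorem rep_delCoeff {q : ℝ} (hq : q ≠ 0) (a b c h k g : Fin 4) :
    Rep q 8 (delCoeff q a b c h k g) (pDelCoeff a b c h k g) :=
  .sum fun e => (rep_RLinv hq b e g c).mul (rep_RLinv hq a h k e)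

theorem delCoeff_cert : (all4 fun a => all4 fun b => all4 fun c => all4 fun h => all4 fun k =>
    all4 fun g => peq
      (psum4 fun u => psum4 fun v => pmul (pRM u v g k) (pDelCoeff a b c h u v))
      (psum4 fun u => psum4 fun v => pmul (pRM a b u v) (pDelCoeff v u c h k g))) = true := by
  decide +kernel

/-- A mixed Yang-Baxter equation: it does not matter whether R_M acts on a pair of derivatives
before or after both are moved past a coordinate. -/
theorem RM_delCoeff {q : ℝ} (hq : q ≠ 0) (a b c h k g : Fin 4) :
    ∑ u, ∑ v, RM q u v g k * delCoeff q a b c h u v =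
      ∑ u, ∑ v, RM q a b u v * delCoeff q v u c h k g := by
  have h0 : (q : ℂ) ≠ 0 := by exact_mod_cast hq
  exact Rep.eq h0 (s := 12)
    (.sum fun u => .sum fun v => (rep_RM hq u v g k).mul (rep_delCoeff hq a b c h u v))
    (.sum fun u => .sum fun v => (rep_RM hq a b u v).mul (rep_delCoeff hq v u c h k g))
    (all4_apply (all4_apply (all4_apply (all4_apply (all4_apply (all4_apply delCoeff_cert a) b) c)
      h) k) g)

theorem del_del_x_mul {q : ℝ} (hq : q ≠ 0) (a b c : Fin 4) (f : Mq q) :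
    del hq a (del hq b (x q c * f)) =
      ∑ g, ((if b = c then 1 else 0) * (if a = g then 1 else 0) + RLinv q b a g c) • del hq g f +
        ∑ h, ∑ k, ∑ g, delCoeff q a b c h k g • (x q h * del hq k (del hq g f)) := by
  simp only [del_x_mul, map_add, map_sum, map_smul, smul_add, Finset.sum_add_distrib, add_smul,
    delCoeff, Finset.sum_smul, Finset.smul_sum, smul_smul]
  rw [add_assoc]
  -- The three parts are: the inner δ, the outer δ, and the term in which both derivatives pass the
  -- coordinate.
  refine congrArg₂ (· + ·) ?_ (congrArg₂ (· + ·) ?_ ?_)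
  · by_cases h : b = c <;> simp [h]
  · simp
  · calc
      _ = ∑ g, ∑ k, ∑ h, ∑ e, (RLinv q b e g c * RLinv q a h k e) •
          (x q h * del hq k (del hq g f)) := by
        exact Finset.sum_congr rfl fun g _ => (sum_rot3 _).symm
      _ = ∑ h, ∑ g, ∑ k, ∑ e, (RLinv q b e g c * RLinv q a h k e) •
          (x q h * del hq k (del hq g f)) := sum_rot3 _
      _ = _ := Finset.sum_congr rfl fun h _ => Finset.sum_comm

/-- The elements of `M_q` on which the braided derivatives commute up to `R_M`. -/
def commSubmodule {q : ℝ} (hq : q ≠ 0) : Submodule ℂ (Mq q) where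
  carrier := {f | ∀ a b, del hq a (del hq b f) =
    ∑ c, ∑ d, RM q a b c d • del hq d (del hq c f)}
  zero_mem' a b := by simp
  add_mem' {f g} hf hg a b := by
    simp only [map_add, smul_add, Finset.sum_add_distrib]
    rw [hf a b, hg a b]
  smul_mem' r f hf a b := by
    simp only [map_smul, smul_comm _ r, ← Finset.smul_sum]
    rw [hf a b]

theorem sum_comm_two_two {B : Type*} [AddCommMonoid B] (G : Fin 4 → Fin 4 → Fin 4 → Fin 4 → B) :
    ∑ a, ∑ b, ∑ c, ∑ d, G a b c d = ∑ c, ∑ d, ∑ a, ∑ b, G a b c d := by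
  rw [sum_rot3]
  exact Finset.sum_congr rfl fun c _ => sum_rot3 _

/-- First-order terms agree by `del_del_linear`. In the second-order terms the relation for f
introduces R_M next to the inner derivatives, and `RM_delCoeff` carries it over to the outer indices
a, b. -/
theorem x_mul_mem {q : ℝ} (hq : q ≠ 0) (c : Fin 4) {f : Mq q} (hf : f ∈ commSubmodule hq) :
    x q c * f ∈ commSubmodule hq := by
  intro a b
  simp only [del_del_x_mul, smul_add, Finset.sum_add_distrib]
  refine congrArg₂ (· + ·) ?_ ?_
  · simp only [del_del_linear hq a b, Finset.sum_smul, Finset.smul_sum, smul_smul]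
    exact (sum_rot3 _).symm
  · simp only [Finset.smul_sum, smul_smul]
    calc
      _ = ∑ h, ∑ u, ∑ v, delCoeff q a b c h u v •
          (x q h * ∑ g, ∑ k, RM q u v g k • del hq k (del hq g f)) := by
        refine Finset.sum_congr rfl fun h _ => Finset.sum_congr rfl fun u _ =>
          Finset.sum_congr rfl fun v _ => ?_
        rw [← hf u v]
      _ = ∑ h, ∑ g, ∑ k, ∑ u, ∑ v, (RM q u v g k * delCoeff q a b c h u v) •
          (x q h * del hq k (del hq g f)) := by
        refine Finset.sum_congr rfl fun h _ => ?_
        simp only [Finset.mul_sum, mul_smul_comm, Finset.smul_sum, smul_smul]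
        rw [sum_comm_two_two]
        simp only [mul_comm]
      _ = ∑ h, ∑ k, ∑ g, ∑ u, ∑ v, (RM q a b u v * delCoeff q v u c h k g) •
          (x q h * del hq k (del hq g f)) := by
        refine Finset.sum_congr rfl fun h _ => ?_
        rw [Finset.sum_comm]
        refine Finset.sum_congr rfl fun k _ => Finset.sum_congr rfl fun g _ => ?_
        simp only [← Finset.sum_smul]
        rw [RM_delCoeff hq]
      _ = ∑ h, ∑ u, ∑ v, ∑ k, ∑ g, (RM q a b u v * delCoeff q v u c h k g) •
          (x q h * del hq k (del hq g f)) :=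
        Finset.sum_congr rfl fun h _ => sum_comm_two_two _
      _ = _ := (sum_rot3 _).symm

/-- The commutation relations `∂^a ∂^b = R_M^{ab}_{cd} ∂^d ∂^c`. -/
theorem del_del {q : ℝ} (hq : q ≠ 0) (a b : Fin 4) (f : Mq q) :
    del hq a (del hq b f) = ∑ c, ∑ d, RM q a b c d • del hq d (del hq c f) := by
  -- Stability under left multiplication by g, rather than membership of g alone, makes the
  -- induction pass through products.
  have key : ∀ (g : FreeAlgebra ℂ (Fin 4)) (f : Mq q), f ∈ commSubmodule hq →
      RingQuot.mkAlgHom ℂ (Rel q) g * f ∈ commSubmodule hq := by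
    intro g
    induction g using FreeAlgebra.induction with
    | grade0 r =>
      intro f hf
      rw [AlgHom.commutes, ← Algebra.smul_def]
      exact Submodule.smul_mem _ r hf
    | grade1 c => exact fun f hf => x_mul_mem hq c hf
    | mul g g' hg hg' =>
      intro f hf
      rw [map_mul, mul_assoc]
      exact hg _ (hg' f hf)
    | add g g' hg hg' =>
      intro f hf
      rw [map_add, add_mul]
      exact Submodule.add_mem _ (hg f hf) (hg' f hf)
  have one : (1 : Mq q) ∈ commSubmodule hq := fun a b => by simp [del_one]
  obtain ⟨g, rfl⟩ := RingQuot.mkAlgHom_surjective ℂ (Rel q) f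
  have := key g 1 one
  rw [mul_one] at this
  exact this a b

/-! ### The Maxwell operator modulo the commutation relations -/

/-- The coefficient of `∂^i ∂^j A_h` in the difference of `n_2 ∂^c ∂_[c A_z]` and
`2 q² (□ A_z - ∂_z ∂^c A_c)`, for `κ = 1`. -/
def maxwellDiff (q : ℝ) (z h i j : Fin 4) : ℂ :=
  ∑ f, metInv q f j * epsTwo q f h i z -
    2 * (q : ℂ) ^ 2 * ((if h = z then 1 else 0) * metInv q i j -
      (if j = h then 1 else 0) * metInv q z i)

def pMaxwellDiff (z h i j : ℕ) : List ℤ :=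
  padd (psum4 fun f => pmul (pMetInv f j) (pEpsTwo f h i z))
    (psmul (-1) (pshift 12 (pmul [0, 0, 2] (padd (pmul (pkron h z) (pMetInv i j))
      (psmul (-1) (pmul (pkron j h) (pMetInv z i)))))))

theorem rep_maxwellDiff {q : ℝ} (hq : q ≠ 0) (z h i j : Fin 4) :
    Rep q 14 (maxwellDiff q z h i j) (pMaxwellDiff z h i j) := by
  have h2 : Rep q 0 (2 * (q : ℂ) ^ 2) [0, 0, 2] := by
    simp [Rep, ev]
    ring
  exact (Rep.sum fun f => (rep_metInv hq f j).mul (rep_epsTwo hq f h i z)).sub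
    ((h2.mul (((rep_kron q h z).mul (rep_metInv hq i j)).sub
      ((rep_kron q j h).mul (rep_metInv hq z i)))).shift 12)

/-- The product of `maxwellDiff` with `q² R_M + 1 + q² + q⁴`. -/
def maxwellDiffRM (q : ℝ) (z h k l : Fin 4) : ℂ :=
  (1 + (q : ℂ) ^ 2 + (q : ℂ) ^ 4) * maxwellDiff q z h k l +
    (q : ℂ) ^ 2 * ∑ i, ∑ j, RM q i j l k * maxwellDiff q z h i j

def pMaxwellDiffRM (z h k l : ℕ) : List ℤ :=
  padd (pshift 4 (pmul [1, 0, 1, 0, 1] (pMaxwellDiff z h k l)))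
    (pmul [0, 0, 1] (psum4 fun i => psum4 fun j => pmul (pRM i j l k) (pMaxwellDiff z h i j)))

theorem rep_maxwellDiffRM {q : ℝ} (hq : q ≠ 0) (z h k l : Fin 4) :
    Rep q 18 (maxwellDiffRM q z h k l) (pMaxwellDiffRM z h k l) := by
  have h2 : Rep q 0 ((q : ℂ) ^ 2) [0, 0, 1] := by
    simp [Rep, ev]
    ring
  have h4 : Rep q 0 (1 + (q : ℂ) ^ 2 + (q : ℂ) ^ 4) [1, 0, 1, 0, 1] := by
    simp [Rep, ev]
    ring
  exact ((h4.mul (rep_maxwellDiff hq z h k l)).shift 4).add (h2.mul (.sum fun i => .sum fun j =>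
    (rep_RM hq i j l k).mul (rep_maxwellDiff hq z h i j)))

theorem maxwellDiff_cert : (all4 fun z => all4 fun h => all4 fun i => all4 fun j => peq
    (pshift 8 (pmul [1, 0, 2, 0, 1] (pMaxwellDiff z h i j)))
    (padd (pshift 4 (pMaxwellDiffRM z h i j)) (psmul (-1) (psum4 fun k => psum4 fun l =>
      pmul (pRM k l j i) (pMaxwellDiffRM z h k l))))) = true := by
  decide +kernel

/-- With M as above, `(q² M + 1 + q² + q⁴)(1 - M) = (1 + q²)² - (q² M + 1)(M + q²)`, and the last
product annihilates `maxwellDiff` from the right. The factor `q² M + 1 + q² + q⁴` is thus, up to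
n_2, the inverse of `1 - M` on these rows; n_2 is the value of `(q² t + 1)(t + q²)` at t = 1. -/
theorem maxwellDiff_eq {q : ℝ} (hq : q ≠ 0) (z h i j : Fin 4) :
    (nrm q 2 : ℂ) * maxwellDiff q z h i j =
      maxwellDiffRM q z h i j - ∑ k, ∑ l, RM q k l j i * maxwellDiffRM q z h k l := by
  have h0 : (q : ℂ) ≠ 0 := by exact_mod_cast hq
  have hn : Rep q 0 (nrm q 2 : ℂ) [1, 0, 2, 0, 1] := by
    simp [Rep, nrm, ev]
    ring
  exact Rep.eq h0 (s := 22) ((hn.mul (rep_maxwellDiff hq z h i j)).shift 8)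
    (((rep_maxwellDiffRM hq z h i j).shift 4).sub (.sum fun k => .sum fun l =>
      (rep_RM hq k l j i).mul (rep_maxwellDiffRM hq z h k l)))
    (all4_apply (all4_apply (all4_apply (all4_apply maxwellDiff_cert z) h) i) j)

theorem nrm_two_ne_zero (q : ℝ) : (nrm q 2 : ℂ) ≠ 0 := by
  have : 0 < nrm q 2 := by simp only [nrm]; positivity
  exact_mod_cast this.ne'

theorem maxwellDiff_del_del {q : ℝ} (hq : q ≠ 0) (z h : Fin 4) (f : Mq q) :
    ∑ i, ∑ j, maxwellDiff q z h i j • del hq i (del hq j f) = 0 := by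
  -- After multiplication by n_2 the coefficients are `N - N M` with N = `maxwellDiffRM`, and `N ∂∂
  -- = N M ∂∂` by `del_del`.
  rw [← smul_eq_zero_iff_right (nrm_two_ne_zero q)]
  simp only [Finset.smul_sum, smul_smul, maxwellDiff_eq hq, sub_smul, Finset.sum_sub_distrib]
  rw [sub_eq_zero]
  calc
    _ = ∑ k, ∑ l, maxwellDiffRM q z h k l •
        ∑ j, ∑ i, RM q k l j i • del hq i (del hq j f) := by
      refine Finset.sum_congr rfl fun k _ => Finset.sum_congr rfl fun l _ => ?_
      rw [← del_del hq k l]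
    _ = _ := by
      simp only [Finset.smul_sum, Finset.sum_smul, smul_smul]
      rw [sum_comm_two_two, Finset.sum_comm]
      simp only [mul_comm]

/-! ## Components of forms -/

theorem sum_idx_succ {B : Type*} [AddCommMonoid B] {n : ℕ} (F : Idx (n + 1) → B) :
    ∑ a, F a = ∑ i, ∑ b : Idx n, F (Fin.cons i b) := by
  rw [← Fintype.sum_prod_type']
  exact (Fintype.sum_equiv (Fin.consEquiv fun _ => Fin 4) _ _ fun _ => rfl).symm

theorem sum_idx_one {B : Type*} [AddCommMonoid B] (F : Idx 1 → B) : ∑ a, F a = ∑ i, F ![i] := by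
  rw [sum_idx_succ]
  exact Finset.sum_congr rfl fun i _ => Fintype.sum_unique _

theorem sum_idx_two {B : Type*} [AddCommMonoid B] (F : Idx 2 → B) :
    ∑ a, F a = ∑ i, ∑ j, F ![i, j] := by
  rw [sum_idx_succ]
  exact Finset.sum_congr rfl fun i _ => sum_idx_one _

theorem sum_idx_three {B : Type*} [AddCommMonoid B] (F : Idx 3 → B) :
    ∑ a, F a = ∑ i, ∑ j, ∑ k, F ![i, j, k] := by
  rw [sum_idx_succ]
  exact Finset.sum_congr rfl fun i _ => sum_idx_two _

theorem sum_idx_four {B : Type*} [AddCommMonoid B] (F : Idx 4 → B) :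
    ∑ a, F a = ∑ i, ∑ j, ∑ k, ∑ l, F ![i, j, k, l] := by
  rw [sum_idx_succ]
  exact Finset.sum_congr rfl fun i _ => sum_idx_three _

theorem sum_rot4 {B : Type*} [AddCommMonoid B] (G : Fin 4 → Fin 4 → Fin 4 → Fin 4 → B) :
    ∑ a, ∑ b, ∑ c, ∑ d, G a b c d = ∑ d, ∑ a, ∑ b, ∑ c, G a b c d := by
  rw [Finset.sum_congr rfl fun a _ => sum_rot3 (G a), Finset.sum_comm]

theorem sum_comm_three_three {B : Type*} [AddCommMonoid B]
    (G : Fin 4 → Fin 4 → Fin 4 → Fin 4 → Fin 4 → Fin 4 → B) :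
    ∑ a, ∑ b, ∑ c, ∑ d, ∑ e, ∑ f, G a b c d e f = ∑ d, ∑ e, ∑ f, ∑ a, ∑ b, ∑ c, G a b c d e f := by
  rw [sum_rot4]
  refine Finset.sum_congr rfl fun d _ => ?_
  rw [sum_rot4]
  exact Finset.sum_congr rfl fun e _ => sum_rot4 _

/-- The contraction `ε^{mfed} ε_{mabc}`, which is `-n_3` times the q-antisymmetriser of three
indices for `κ = 1`. -/
def epsThree (q : ℝ) (d e f a b c : Fin 4) : ℂ := ∑ m, epsVal q m a b c * epsRaised q m f e d

/-- The q-Hodge star on 3-forms does not see the q-antisymmetriser. -/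
theorem starThree_epsThree {q : ℝ} (hq : q ≠ 0) (z d e f : Fin 4) :
    ∑ a, ∑ b, ∑ c, starThree q z a b c * epsThree q d e f a b c =
      -(nrm q 3 : ℂ) * starThree q z d e f := by
  rw [← metInv_epsRaised hq, Finset.mul_sum]
  simp only [← mul_assoc, ← starThree_eps hq, Finset.sum_mul, Finset.mul_sum, epsThree]
  exact sum_rot4 _

/-! ### Antisymmetrisers, stars and exterior derivatives in components -/

theorem epsUp_apply {q : ℝ} (hq : q ≠ 0) (κ : ℝ) (a b c d : Fin 4) :
    epsUp q κ ![a, b, c, d] = (κ : ℂ) ^ 4 * epsRaised q a b c d := by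
  simp only [epsUp, sum_idx_four, Fin.prod_univ_four, gUp_apply hq, epsRaised, Finset.mul_sum, eps]
  refine Finset.sum_congr rfl fun i _ => Finset.sum_congr rfl fun j _ =>
    Finset.sum_congr rfl fun k _ => Finset.sum_congr rfl fun l _ => ?_
  simp
  ring

theorem asym_two {q : ℝ} (hq : q ≠ 0) (κ : ℝ) (c d a b : Fin 4) :
    asym q κ 2 ![c, d] ![a, b] = (κ : ℂ) ^ 4 / nrm q 2 * epsTwo q c d a b := by
  -- The upper ε takes the list c, d, m, n in reverse order.
  have h1 : ∀ m n : Fin 4, (fun i => cat ![c, d] ![m, n] i.rev) = ![n, m, d, c] := by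
    intro m n
    funext i
    fin_cases i <;> rfl
  have h2 : ∀ m n : Fin 4, eps q (cat ![m, n] ![a, b]) = epsVal q m n a b := fun _ _ => rfl
  rw [asym, if_pos (by norm_num)]
  change (-1) ^ 2 / (nrm q 2 : ℂ) * (∑ m : Idx 2, _) = _
  rw [sum_idx_two]
  simp only [h1, h2, epsUp_apply hq, epsTwo, Finset.mul_sum]
  refine Finset.sum_congr rfl fun m _ => Finset.sum_congr rfl fun n _ => ?_
  ring

theorem asym_three {q : ℝ} (hq : q ≠ 0) (κ : ℝ) (d e f a b c : Fin 4) :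
    asym q κ 3 ![d, e, f] ![a, b, c] =
      -((κ : ℂ) ^ 4 / nrm q 3) * epsThree q d e f a b c := by
  have h1 : ∀ m : Fin 4, (fun i => cat ![d, e, f] ![m] i.rev) = ![m, f, e, d] := by
    intro m
    funext i
    fin_cases i <;> rfl
  have h2 : ∀ m : Fin 4, eps q (cat ![m] ![a, b, c]) = epsVal q m a b c := fun _ => rfl
  rw [asym, if_pos (by norm_num)]
  change (-1) ^ 3 / (nrm q 3 : ℂ) * (∑ m : Idx 1, _) = _
  rw [sum_idx_one]
  simp only [h1, h2, epsUp_apply hq, epsThree, Finset.mul_sum]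
  refine Finset.sum_congr rfl fun m _ => ?_
  ring

/-- The normalisation `n_p^{-1/2}` of the q-Hodge star. -/
def starNorm (q : ℝ) (p : ℕ) : ℂ := (((Real.sqrt (nrm q p))⁻¹ : ℝ) : ℂ)

theorem hodge_two {q : ℝ} (hq : q ≠ 0) (κ : ℝ) (w : Form q 2) (a b : Fin 4) :
    (hodge hq κ w).1 ![a, b] =
      (starNorm q 2 * κ ^ 2) • ∑ c, ∑ d, starTwo q a b c d • w.1 ![c, d] := by
  change ∑ s : Idx 2, ∑ t : Idx 2, (starNorm q 2 * eps q (cat ![a, b] s) *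
    ∏ i, gUp q κ (s i) (t i.rev)) • w.1 t = _
  rw [Finset.sum_comm]
  simp only [sum_idx_two, starTwo, Finset.smul_sum, Finset.sum_smul, Finset.mul_sum, smul_smul,
    Fin.prod_univ_two, gUp_apply hq]
  refine Finset.sum_congr rfl fun c _ => Finset.sum_congr rfl fun d _ =>
    Finset.sum_congr rfl fun i _ => Finset.sum_congr rfl fun j _ => ?_
  refine congrArg (· • w.1 ![c, d]) ?_
  change starNorm q 2 * epsVal q a b i j * (κ * met q i d * (κ * met q j c)) = _
  ring

set_option maxRecDepth 4000 in
theorem hodge_three {q : ℝ} (hq : q ≠ 0) (κ : ℝ) (w : Form q 3) (z : Fin 4) :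
    (hodge hq κ w).1 ![z] =
      (starNorm q 3 * κ ^ 3) • ∑ a, ∑ b, ∑ c, starThree q z a b c • w.1 ![a, b, c] := by
  change ∑ s : Idx 3, ∑ t : Idx 3, (starNorm q 3 * eps q (cat ![z] s) *
    ∏ i, gUp q κ (s i) (t i.rev)) • w.1 t = _
  rw [Finset.sum_comm]
  simp only [sum_idx_three, starThree, Finset.smul_sum, Finset.sum_smul, Finset.mul_sum, smul_smul,
    Fin.prod_univ_three, gUp_apply hq]
  refine Finset.sum_congr rfl fun a _ => Finset.sum_congr rfl fun b _ =>
    Finset.sum_congr rfl fun c _ => Finset.sum_congr rfl fun i _ =>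
    Finset.sum_congr rfl fun j _ => Finset.sum_congr rfl fun k _ => ?_
  refine congrArg (· • w.1 ![a, b, c]) ?_
  change starNorm q 3 * epsVal q z i j k *
    (κ * met q i c * (κ * met q j b) * (κ * met q k a)) = _
  ring

theorem extDeriv_one {q : ℝ} (hq : q ≠ 0) (κ : ℝ) (w : Form q 1) (a b : Fin 4) :
    (extDeriv hq κ w).1 ![a, b] =
      ((κ : ℂ) ^ 4 / nrm q 2) • ∑ c, ∑ d, epsTwo q c d a b • delLow hq κ c (comp w d) := by
  change ∑ s : Idx 2, asym q κ 2 s ![a, b] • delLow hq κ (s 0) (w.1 (Fin.tail s)) = _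
  rw [sum_idx_two]
  simp only [asym_two hq, Finset.smul_sum, smul_smul]
  rfl

theorem extDeriv_two {q : ℝ} (hq : q ≠ 0) (κ : ℝ) (w : Form q 2) (a b c : Fin 4) :
    (extDeriv hq κ w).1 ![a, b, c] = (-((κ : ℂ) ^ 4 / nrm q 3)) • ∑ d, ∑ e, ∑ f,
      epsThree q d e f a b c • delLow hq κ d (w.1 ![e, f]) := by
  change ∑ s : Idx 3, asym q κ 3 s ![a, b, c] • delLow hq κ (s 0) (w.1 (Fin.tail s)) = _
  rw [sum_idx_three]
  simp only [asym_three hq, Finset.smul_sum, smul_smul]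
  rfl

theorem curl_apply {q : ℝ} (hq : q ≠ 0) (κ : ℝ) (A : Form q 1) (c z : Fin 4) :
    curl hq κ A c z =
      ((κ : ℂ) ^ 4 / nrm q 2) • ∑ f, ∑ h, epsTwo q f h c z • delLow hq κ f (comp A h) := by
  simp only [curl, asym_two hq, Finset.smul_sum, smul_smul]

theorem nrm_three_ne_zero (q : ℝ) : (nrm q 3 : ℂ) ≠ 0 := by
  have : 0 < nrm q 3 := by simp only [nrm]; positivity
  exact_mod_cast this.ne'

/-- The q-Hodge star of `dA` as a contraction of `∂_f A_h`. -/
theorem hodge_extDeriv_one {q : ℝ} (hq : q ≠ 0) (κ : ℝ) (A : Form q 1) (a b : Fin 4) :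
    (hodge hq κ (extDeriv hq κ A)).1 ![a, b] =
      (starNorm q 2 * κ ^ 6) • ∑ f, ∑ h, starTwo q a b f h • delLow hq κ f (comp A h) := by
  have hn := nrm_two_ne_zero q
  rw [hodge_two]
  calc
    _ = (starNorm q 2 * κ ^ 6 / nrm q 2) • ∑ f, ∑ h, (∑ c, ∑ d,
        starTwo q a b c d * epsTwo q f h c d) • delLow hq κ f (comp A h) := by
      simp only [extDeriv_one, Finset.smul_sum, Finset.sum_smul, smul_smul]
      rw [sum_comm_two_two]
      refine Finset.sum_congr rfl fun f _ => Finset.sum_congr rfl fun h _ =>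
        Finset.sum_congr rfl fun c _ => Finset.sum_congr rfl fun d _ => ?_
      refine congrArg₂ (· • ·) ?_ rfl
      ring
    _ = _ := by
      -- The factor n_2 produced here cancels the normalisation of the antisymmetriser.
      simp only [starTwo_epsTwo hq, Finset.smul_sum, smul_smul]
      refine Finset.sum_congr rfl fun f _ => Finset.sum_congr rfl fun h _ => ?_
      refine congrArg₂ (· • ·) ?_ rfl
      field_simp

/-- The q-Hodge star of `dw` for a 2-form `w` as a contraction of `∂_d w_{ef}`. -/
theorem hodge_extDeriv_two {q : ℝ} (hq : q ≠ 0) (κ : ℝ) (w : Form q 2) (z : Fin 4) :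
    (hodge hq κ (extDeriv hq κ w)).1 ![z] = (starNorm q 3 * κ ^ 7) •
      ∑ d, ∑ e, ∑ f, starThree q z d e f • delLow hq κ d (w.1 ![e, f]) := by
  have hn := nrm_three_ne_zero q
  rw [hodge_three]
  calc
    _ = (-(starNorm q 3 * κ ^ 7) / nrm q 3) • ∑ d, ∑ e, ∑ f, (∑ a, ∑ b, ∑ c,
        starThree q z a b c * epsThree q d e f a b c) • delLow hq κ d (w.1 ![e, f]) := by
      simp only [extDeriv_two, Finset.smul_sum, Finset.sum_smul, smul_smul]
      rw [sum_comm_three_three]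
      refine Finset.sum_congr rfl fun d _ => Finset.sum_congr rfl fun e _ =>
        Finset.sum_congr rfl fun f _ => Finset.sum_congr rfl fun a _ =>
        Finset.sum_congr rfl fun b _ => Finset.sum_congr rfl fun c _ => ?_
      refine congrArg₂ (· • ·) ?_ rfl
      ring
    _ = _ := by
      -- The sign `(-1)^3` of the antisymmetriser cancels against the one in `-n_3`.
      simp only [starThree_epsThree hq, Finset.smul_sum, smul_smul]
      refine Finset.sum_congr rfl fun d _ => Finset.sum_congr rfl fun e _ =>
        Finset.sum_congr rfl fun f _ => ?_
      refine congrArg₂ (· • ·) ?_ rfl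
      field_simp

/-! ## The q-Maxwell equation -/

theorem sum_met_delLow {q κ : ℝ} (hq : q ≠ 0) (hκ : κ ≠ 0) (c : Fin 4) (f : Mq q) :
    ∑ e, met q e c • delLow hq κ e f = (κ : ℂ)⁻¹ • del hq c f := by
  simp only [delLow, LinearMap.sum_apply, LinearMap.smul_apply, gLow_apply hq hκ, Finset.smul_sum,
    smul_smul]
  rw [Finset.sum_comm]
  calc
    _ = ∑ b, ((κ : ℂ)⁻¹ * ∑ e, met q e c * metInv q e b) • del hq b f := by
      simp only [Finset.mul_sum, Finset.sum_smul, mul_left_comm]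
    _ = _ := by
      simp [met_mul_metInv hq]

/-- Once the stars have absorbed both antisymmetrisers, `starThree_starTwo` identifies the product
of their kernels. The power of κ is 7 + 6 from the two star-derivative pairs, less 5 contained in
`∂^c ∂_[c A_z]`. -/
theorem coderiv_extDeriv {q κ : ℝ} (hq : q ≠ 0) (hκ : κ ≠ 0) (A : Form q 1) (z : Fin 4) :
    (coderiv hq κ (extDeriv hq κ A)).1 ![z] =
      (-(starNorm q 3 * starNorm q 2 * κ ^ 8 * nrm q 2)) • ∑ c, del hq c (curl hq κ A c z) := by
  have hk : (κ : ℂ) ≠ 0 := by exact_mod_cast hκ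
  have hn := nrm_two_ne_zero q
  -- The degrees `4 - 2` and `4 - (4 - 2 + 1)` reduce to 2 and 1, so the formula for 2-forms applies
  -- to `*dA`.
  have h1 : (coderiv hq κ (extDeriv hq κ A)).1 ![z] = (starNorm q 3 * κ ^ 7) •
      ∑ d, ∑ e, ∑ f, starThree q z d e f •
        delLow hq κ d ((hodge hq κ (extDeriv hq κ A)).1 ![e, f]) :=
    hodge_extDeriv_two hq κ (hodge hq κ (extDeriv hq κ A)) z
  have h2 : ∀ c, del hq c (curl hq κ A c z) = ((κ : ℂ) ^ 5 / nrm q 2) • ∑ e, ∑ f, ∑ h,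
      (met q e c * epsTwo q f h c z) • delLow hq κ e (delLow hq κ f (comp A h)) := by
    intro c
    rw [← smul_inv_smul₀ hk (del hq c _), ← sum_met_delLow hq hκ]
    simp only [curl_apply, map_smul, map_sum, Finset.smul_sum, smul_smul]
    refine Finset.sum_congr rfl fun e _ => Finset.sum_congr rfl fun f _ =>
      Finset.sum_congr rfl fun h _ => ?_
    refine congrArg₂ (· • ·) ?_ rfl
    ring
  rw [h1]
  calc
    _ = (starNorm q 3 * starNorm q 2 * κ ^ 13) • ∑ d, ∑ f, ∑ h, (∑ a, ∑ b,
        starThree q z d a b * starTwo q a b f h) • delLow hq κ d (delLow hq κ f (comp A h)) := by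
      simp only [hodge_extDeriv_one, map_smul, map_sum, Finset.smul_sum, Finset.sum_smul, smul_smul]
      refine Finset.sum_congr rfl fun d _ => ?_
      rw [sum_comm_two_two]
      refine Finset.sum_congr rfl fun f _ => Finset.sum_congr rfl fun h _ =>
        Finset.sum_congr rfl fun a _ => Finset.sum_congr rfl fun b _ => ?_
      refine congrArg₂ (· • ·) ?_ rfl
      ring
    _ = _ := by
      simp only [starThree_starTwo hq, h2, ← Finset.sum_neg_distrib, Finset.smul_sum,
        Finset.sum_smul, smul_smul]
      rw [sum_rot4]
      refine Finset.sum_congr rfl fun c _ => Finset.sum_congr rfl fun d _ =>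
        Finset.sum_congr rfl fun f _ => Finset.sum_congr rfl fun h _ => ?_
      refine congrArg₂ (· • ·) ?_ rfl
      field_simp

/-! ### The d'Alembert form of the equation -/

theorem box_apply {q κ : ℝ} (hq : q ≠ 0) (hκ : κ ≠ 0) (f : Mq q) :
    box hq κ f = (κ : ℂ)⁻¹ • ∑ i, ∑ j, metInv q i j • del hq i (del hq j f) := by
  have hk : (κ : ℂ) ≠ 0 := by exact_mod_cast hκ
  simp only [box, LinearMap.sum_apply, LinearMap.smul_apply, LinearMap.comp_apply, gUp_apply hq,
    mul_smul, ← Finset.smul_sum]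
  -- Summing over the index of the outer derivative first raises it, so that the operator becomes
  -- `∂^b ∂_b`.
  rw [Finset.sum_comm]
  simp only [sum_met_delLow hq hκ, ← Finset.smul_sum, smul_inv_smul₀ hk]
  simp only [delLow, LinearMap.sum_apply, LinearMap.smul_apply, gLow_apply hq hκ, map_sum, map_smul,
    Finset.smul_sum, smul_smul]

theorem sum_sub_smul {B : Type*} [AddCommGroup B] [Module ℂ B]
    (r s : Fin 4 → Fin 4 → Fin 4 → ℂ) (V : Fin 4 → Fin 4 → Fin 4 → B) :
    ∑ h, ∑ i, ∑ j, (r h i j - s h i j) • V h i j =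
      ∑ h, ∑ i, ∑ j, r h i j • V h i j - ∑ h, ∑ i, ∑ j, s h i j • V h i j := by
  simp only [sub_smul, Finset.sum_sub_distrib]

theorem smul_sum_sub_smul {B : Type*} [AddCommGroup B] [Module ℂ B] (t : ℂ)
    (r s : Fin 4 → Fin 4 → Fin 4 → ℂ) (V : Fin 4 → Fin 4 → Fin 4 → B) :
    t • ∑ h, ∑ i, ∑ j, (r h i j - s h i j) • V h i j =
      t • ∑ h, ∑ i, ∑ j, r h i j • V h i j - t • ∑ h, ∑ i, ∑ j, s h i j • V h i j := by
  rw [sum_sub_smul, smul_sub]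

theorem sum_eq_smul_sum {B : Type*} [AddCommGroup B] [Module ℂ B] (t : ℂ)
    (r s : Fin 4 → Fin 4 → Fin 4 → ℂ) (V : Fin 4 → Fin 4 → Fin 4 → B)
    (hV : ∀ h, ∑ i, ∑ j, (r h i j - t * s h i j) • V h i j = 0) :
    ∑ h, ∑ i, ∑ j, r h i j • V h i j = t • ∑ h, ∑ i, ∑ j, s h i j • V h i j := by
  rw [← sub_eq_zero]
  simp only [Finset.smul_sum, smul_smul]
  rw [← sum_sub_smul]
  exact Finset.sum_eq_zero fun h _ => hV h

theorem sum_del_curl {q κ : ℝ} (hq : q ≠ 0) (hκ : κ ≠ 0) (A : Form q 1) (z : Fin 4) :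
    ∑ c, del hq c (curl hq κ A c z) = ((κ : ℂ) ^ 3 / nrm q 2) • ∑ h, ∑ i, ∑ j,
      (∑ f, metInv q f j * epsTwo q f h i z) • del hq i (del hq j (comp A h)) := by
  have hk : (κ : ℂ) ≠ 0 := by exact_mod_cast hκ
  simp only [curl_apply, delLow, LinearMap.sum_apply, LinearMap.smul_apply, gLow_apply hq hκ,
    map_smul, map_sum, Finset.smul_sum, Finset.sum_smul, smul_smul]
  calc
    _ = ∑ c, ∑ h, ∑ j, ∑ f, ((κ : ℂ) ^ 4 / nrm q 2 * (epsTwo q f h c z *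
        ((κ : ℂ)⁻¹ * metInv q f j))) • del hq c (del hq j (comp A h)) :=
      Finset.sum_congr rfl fun c _ => (sum_rot3 fun h j f => ((κ : ℂ) ^ 4 / nrm q 2 *
        (epsTwo q f h c z * ((κ : ℂ)⁻¹ * metInv q f j))) • del hq c (del hq j (comp A h))).symm
    _ = _ := by
      rw [Finset.sum_comm]
      refine Finset.sum_congr rfl fun h _ => Finset.sum_congr rfl fun c _ =>
        Finset.sum_congr rfl fun j _ => Finset.sum_congr rfl fun f _ => ?_
      refine congrArg₂ (· • ·) ?_ rfl
      field_simp

theorem box_sub_apply {q κ : ℝ} (hq : q ≠ 0) (hκ : κ ≠ 0) (A : Form q 1) (z : Fin 4) :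
    box hq κ (comp A z) - delLow hq κ z (∑ c, del hq c (comp A c)) =
      (κ : ℂ)⁻¹ • ∑ h, ∑ i, ∑ j, ((if h = z then 1 else 0) * metInv q i j -
        (if j = h then 1 else 0) * metInv q z i) • del hq i (del hq j (comp A h)) := by
  refine Eq.trans ?_ (smul_sum_sub_smul _ _ _ _).symm
  refine congrArg₂ (· - ·) ?_ ?_
  · rw [box_apply hq hκ]
    refine congrArg _ (Eq.symm ?_)
    rw [Finset.sum_eq_single z] <;> simp +contextual
  · simp [delLow, gLow_apply hq hκ, Finset.smul_sum, smul_smul]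

/-- Both sides are combinations of `∂^i ∂^j A_h`, and their coefficients differ by a multiple of
`maxwellDiff`, which the commutation relations kill for each h. -/
theorem maxwellDiff_apply {q κ : ℝ} (hq : q ≠ 0) (hκ : κ ≠ 0) (A : Form q 1) (z : Fin 4) :
    ∑ c, del hq c (curl hq κ A c z) = (2 * (q : ℂ) ^ 2 * κ ^ 4 / nrm q 2) •
      (box hq κ (comp A z) - delLow hq κ z (∑ c, del hq c (comp A c))) := by
  have hk : (κ : ℂ) ≠ 0 := by exact_mod_cast hκ
  rw [sum_del_curl hq hκ, box_sub_apply hq hκ]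
  -- The scalar found by unfolding `maxwellDiff` is `2q²`.
  have h3 := sum_eq_smul_sum _ _ _ _ fun h => maxwellDiff_del_del hq z h (comp A h)
  refine (congrArg (((κ : ℂ) ^ 3 / nrm q 2) • ·) h3).trans ?_
  simp only [smul_smul]
  refine congrArg₂ (· • ·) ?_ rfl
  field_simp

theorem starNorm_ne_zero (q : ℝ) {p : ℕ} (hp : 0 < nrm q p) : starNorm q p ≠ 0 := by
  rw [starNorm, Complex.ofReal_ne_zero]
  exact inv_ne_zero (Real.sqrt_pos.mpr hp).ne'

end

end QMinkowski

theorem mainTheorem10 (q : ℝ) (hq : q ≠ 0) (κ : ℝ) (hκ : κ ≠ 0) (A : QMinkowski.Form q 1) :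
    (QMinkowski.coderiv hq κ (QMinkowski.extDeriv hq κ A) = 0 ↔
      ∀ z : Fin 4, ∑ c, QMinkowski.del hq c (QMinkowski.curl hq κ A c z) = 0) ∧
    (QMinkowski.coderiv hq κ (QMinkowski.extDeriv hq κ A) = 0 ↔
      ∀ z : Fin 4, QMinkowski.box hq κ (QMinkowski.comp A z) -
        QMinkowski.delLow hq κ z (∑ c, QMinkowski.del hq c (QMinkowski.comp A c)) = 0) := by
  have h0 : (q : ℂ) ≠ 0 := by exact_mod_cast hq
  have hk : (κ : ℂ) ≠ 0 := by exact_mod_cast hκ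
  have hn := QMinkowski.nrm_two_ne_zero q
  have h2 : QMinkowski.starNorm q 2 ≠ 0 :=
    QMinkowski.starNorm_ne_zero q (by simp only [QMinkowski.nrm]; positivity)
  have h3 : QMinkowski.starNorm q 3 ≠ 0 :=
    QMinkowski.starNorm_ne_zero q (by simp only [QMinkowski.nrm]; positivity)
  have key : QMinkowski.coderiv hq κ (QMinkowski.extDeriv hq κ A) = 0 ↔
      ∀ z : Fin 4, ∑ c, QMinkowski.del hq c (QMinkowski.curl hq κ A c z) = 0 := by
    have e : QMinkowski.coderiv hq κ (QMinkowski.extDeriv hq κ A) = 0 ↔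
        ∀ z : Fin 4, (QMinkowski.coderiv hq κ (QMinkowski.extDeriv hq κ A)).1 ![z] = 0 := by
      refine ⟨fun h z => by rw [h]; rfl, fun h => Subtype.ext (funext fun a => ?_)⟩
      -- The length `4 - (4 - 2 + 1)` of the list a reduces to 1.
      have ha : a = ![a (0 : Fin 1)] := by
        funext i
        rw [show i = (0 : Fin 1) from Subsingleton.elim (α := Fin 1) _ _]
        rfl
      rw [ha]
      exact h _
    simp only [e, QMinkowski.coderiv_extDeriv hq hκ]
    refine forall_congr' fun z => smul_eq_zero_iff_right (neg_ne_zero.mpr ?_)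
    exact mul_ne_zero (mul_ne_zero (mul_ne_zero h3 h2) (pow_ne_zero 8 hk)) hn
  refine ⟨key, key.trans (forall_congr' fun z => ?_)⟩
  rw [QMinkowski.maxwellDiff_apply hq hκ]
  exact smul_eq_zero_iff_right
    (div_ne_zero (mul_ne_zero (mul_ne_zero two_ne_zero (pow_ne_zero 2 h0)) (pow_ne_zero 4 hk)) hn)
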